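/- **Theorem (TBFL for the mean-shift model).** *Model.* For each sample size $n\ge 1$ let $1=t_0<t_1<\dots<t_{m_0}<t_{m_0+1}=n+1$ and $y_t=\mu_j^\star+\varepsilon_t\in\mathbb R^{p}$ for $t_{j-1}\le t<t_j$, $j=1,\dots,m_0+1$, with $\mu_{j+1}^\star\ne\mu_j^\star$; $p$, $m_0$, the $t_j$, the $\mu^\star_j$ and the distribution of the errors may depend on $n$. Let $d_n^\star=\max_j|\mathrm{supp}(\mu_j^\star)|$ and $\nu_n=\min_{1\le j\le m_0}\|\mu_{j+1}^\star-\mu_j^\star\|_2$ ($\nu_n=\infty$ if $m_0=0$). *Procedure (TBFL).* Input: a block size $b_n\in\mathbb N$, $b_n\ge1$, parameters $\lambda_{1,n},\lambda_{2,n}$, a threshold $\omega_n$, and thresholds $\eta_{n,j}$. Let $k_n=\lfloor n/b_n\rfloor$, $r_i=1+ib_n$ for $0\le i<k_n$ and $r_{k_n}=n+1$. (I) $(\widehat\Theta_1,\dots,\widehat\Theta_{k_n})$ minimizes $$\frac1n\sum_{i=1}^{k_n}\sum_{t=r_{i-1}}^{r_i-1}\Big\|y_t-\sum_{l\le i}\Theta_l\Big\|_2^2+\lambda_{1,n}\sum_{i=1}^{k_n}\|\Theta_i\|_1+\lambda_{2,n}\sum_{i=1}^{k_n}\Big\|\sum_{l\le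 i}\Theta_l\Big\|_1 .$$ (II) $\widetilde I_n=\{2\le i\le k_n:\|\widehat\Theta_i\|_2>\omega_n\}$, and the candidate change points are the $r_{i-1}$ with $i\in\widetilde I_n$. (III) $\widetilde I_n$ is partitioned into consecutive groups $J_1,\dots,J_{\widetilde m^f}$ (in increasing order) such that each cluster $R_j=\{r_{i-1}:i\in J_j\}$ has diameter at most $b_n$, with the smallest possible number $\widetilde m^f$ of clusters. Put $J_0=\{1\}$, $J_{\widetilde m^f+1}=\{k_n\}$ and $$\widehat\mu_j=\sum_{i=1}^{\lfloor(\max J_{j-1}+\min J_j)/2\rfloor}\widehat\Theta_i,\qquad j=1,\dots,\widetilde m^f+1 .$$ For $1\le j\le\widetilde m^f$ let $(l_j,u_j)=(\min R_j-b_n,\max R_j+b_n)$ if $|R_j|=1$ and $(l_j,u_j)=(\min R_j,\max R_j)$ otherwise, and let $\widetilde t_j^f$ be a minimizer over the integers $s\in(l_j,u_j)$ of $$\sum_{t=\min R_j-b_n}^{s-1}\|y_t-\widehat\mu_j\|_2^2+\sum_{t=s}^{\max R_j+b_n-1}\|y_t-\widehat\mu_{j+1}\|_2^2$$ (an arbitrary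 value if there is no such $s$). Finally $\widetilde\mu_j$ is obtained from $\widehat\mu_j$ by setting to $0$ all entries of absolute value at most $\eta_{n,j}$. Ties in (I) and (III) are broken arbitrarily. *Assumptions.* Let $\overline C_1,\overline C_2>0$ be constants. (B1) $\varepsilon_1,\dots,\varepsilon_n$ are independent; for $t$ in the $j$-th segment, $\varepsilon_t$ has mean zero and covariance matrix $\Sigma_j$, and $\sup_{q\ge1}q^{-1/2}(\mathbb E|u'\varepsilon_t|^q)^{1/q}\le\sigma_j$ for all unit vectors $u$. All eigenvalues of all $\Sigma_j$ lie in $[1/\overline C_1,\overline C_1]$, and $1/\overline C_2<\sigma_j^2<\overline C_2$. (B2) $d_n^\star/p\to0$, and $\max_j\|\mu_j^\star\|_\infty\le M_\mu$ for a constant $M_\mu$. (B3) $\min_{1\le j\le m_0+1}(t_j-t_{j-1})/b_n\to\infty$, $\ d_n^\star\log(p\vee n)/b_n\to0$, and $\nu_n\ge c\sqrt{d_n^\star\log(p\vee n)/b_n}$ for all large $n$. (B4) $\lambda_{i,n}=C_i\sqrt{\log(p\vee n)/n}\,\sqrt{b_n/n}$ for $i=1,2$; and $\omega_n=\varpi\nu_n$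 with $0<\varpi<1/2$. *Claim.* There is $\kappa>0$, depending only on $\overline C_1,\overline C_2$, such that for all constants $C_1,C_2\ge\kappa$ and all $\varpi\in(0,1/2)$ there are constants $c,K>0$, depending only on $\overline C_1,\overline C_2,C_1,C_2,\varpi$, for which the following holds. Whenever (B1)–(B4) hold with these constants, then as $n\to\infty$ $$\mathbb P\Big(\widetilde m^f=m_0,\ \max_{1\le j\le m_0}|\widetilde t_j^f-t_j|\le\frac{K\,d_n^\star\log(p\vee n)}{\nu_n^2}\Big)\to1,$$ $$\max_{1\le j\le m_0+1}\|\widehat\mu_j-\mu_j^\star\|_2=O_p\Big(\sqrt{d_n^\star\log(p\vee n)/b_n}\Big),$$ and, if $\eta_{n,j}=C_{\eta,j}\sqrt{\log(p\vee n)/b_n}$ with positive constants $C_{\eta,j}$, $$\max_{1\le j\le m_0+1}\big|\mathrm{supp}(\widetilde\mu_j)\setminus\mathrm{supp}(\mu_j^\star)\big|=O_p(d_n^\star).$$ (On the event $\widetilde m^f<m_0$, whose probability tends to zero, the undefined $\widehat\mu_j$ may be chosen arbitrarily.) -/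

import Mathlib

open MeasureTheory ProbabilityTheory Filter Topology
open scoped ENNReal

noncomputable section

namespace TBFL

/-! ### Vectors, sub-Gaussian vectors, stochastic order -/

/-- Vectors of `ℝ^p` with the Euclidean norm. -/
abbrev Vec (p : ℕ) : Type := EuclideanSpace ℝ (Fin p)

/-- The `ℓ₁` norm of a vector. -/
def l1 {p : ℕ} (v : Vec p) : ℝ := ∑ h, |v h|

/-- The support of a vector. -/
def supp {p : ℕ} (v : Vec p) : Finset (Fin p) := Finset.univ.filter fun h => v h ≠ 0

/-- `‖X‖_{ψ₂} = sup_{q ≥ 1} q^{-1/2} (E|X|^q)^{1/q}`, with values in `[0, ∞]`. -/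
def psi2Norm {Ω : Type*} [MeasurableSpace Ω] (P : Measure Ω) (X : Ω → ℝ) : ℝ≥0∞ :=
  ⨆ q : {q : ℝ // 1 ≤ q},
    ENNReal.ofReal ((q : ℝ) ^ (-(1 / 2) : ℝ)) * eLpNorm X (ENNReal.ofReal q) P

/-- `X` is a sub-Gaussian random vector with parameters `(S, σ²)`: it has mean zero and covariance
matrix `S`, and every projection `u'X` on a unit vector has `ψ₂` norm at most `σ`. -/
structure IsSubGaussianVector {Ω : Type*} [MeasurableSpace Ω] (P : Measure Ω) {p : ℕ}
    (X : Ω → Vec p) (S : Matrix (Fin p) (Fin p) ℝ) (σ : ℝ) : Prop where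
  measurable : Measurable X
  mean_zero : ∀ h, ∫ w, X w h ∂P = 0
  covariance : ∀ h l, ∫ w, X w h * X w l ∂P = S h l
  psi2 : ∀ u : Vec p, ‖u‖ = 1 → psi2Norm P (fun w => inner ℝ u (X w)) ≤ ENNReal.ofReal σ

/-- `X n = O_p(a n)`, where the `n`-th variable lives on its own probability space. The measure of
a set that is not measurable is its outer measure. -/
def IsBigOp {Ω : ℕ → Type*} [∀ n, MeasurableSpace (Ω n)] (P : ∀ n, Measure (Ω n))
    (X : ∀ n, Ω n → ℝ) (a : ℕ → ℝ) : Prop :=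
  ∀ δ : ℝ, 0 < δ → ∃ M : ℝ, 0 < M ∧
    ∀ᶠ n in atTop, P n {w | M * a n < |X n w|} ≤ ENNReal.ofReal δ

/-! ### The piecewise constant mean model -/

/-- The parameters of a mean-shift model in dimension `p`: the number `m₀` of change points, the
points `t_0 < t_1 < ⋯ < t_{m₀} < t_{m₀+1}`, and the mean vectors of the `m₀ + 1` segments; the
segment with index `j` (starting from `0`) consists of the times `t_j ≤ t < t_{j+1}`. -/
structure Params (p : ℕ) where
  m₀ : ℕ
  cp : Fin (m₀ + 2) → ℕ
  mean : Fin (m₀ + 1) → Vec p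

namespace Params

variable {p : ℕ} (S : Params p)

/-- The parameters describe a sample of size `n`: `t_0 = 1`, `t_{m₀+1} = n + 1`, the points `t_j`
increase, and the mean does change at each of `t_1, …, t_{m₀}`. -/
structure IsModel (n : ℕ) : Prop where
  first : S.cp 0 = 1
  last : S.cp (Fin.last _) = n + 1
  strictMono : StrictMono S.cp
  change : ∀ j : Fin S.m₀, S.mean j.succ ≠ S.mean j.castSucc

/-- The time `t` lies in the segment `j`. -/
def InSegment (j : Fin (S.m₀ + 1)) (t : ℕ) : Prop := S.cp j.castSucc ≤ t ∧ t < S.cp j.succ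

open Classical in
/-- The observation at time `t`, when the error at that time is `e`:
`∑_j (μ_j + e) 1{t_{j-1} ≤ t < t_j}`. -/
def obs (t : ℕ) (e : Vec p) : Vec p :=
  ∑ j, if S.InSegment j t then S.mean j + e else 0

/-- The maximal sparsity: the largest number of nonzero entries of a mean vector. -/
def sparsity : ℕ := Finset.univ.sup fun j => (supp (S.mean j)).card

/-- The smallest jump size `ν = min_j ‖μ_{j+1} - μ_j‖₂`; it is `∞` if there is no change point. -/
def minJump : ℝ≥0∞ := ⨅ j : Fin S.m₀, ENNReal.ofReal ‖S.mean j.succ - S.mean j.castSucc‖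

/-- The smallest length of a segment. -/
def minLength : ℕ := ⨅ j : Fin (S.m₀ + 1), (S.cp j.succ - S.cp j.castSucc)

end Params

/-! ### The estimator: block fused lasso, hard thresholding, exhaustive search -/

/-- The end points of the blocks: with `k = ⌊n/b⌋` blocks, `r_i = 1 + i b` for `i < k` and
`r_k = n + 1`. Block `i` (for `1 ≤ i ≤ k`) consists of the times `r_{i-1} ≤ t < r_i`. -/
def blockEnd (n b i : ℕ) : ℕ := if i < n / b then 1 + i * b else n + 1

/-- The block fused lasso objective at `Θ = (Θ_1, …, Θ_k)` (the values of `Θ` at other indices are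
not used): `n⁻¹ ∑_t ‖y_t - ∑_{j ≤ i(t)} Θ_j‖² + λ₁ ∑_i ‖Θ_i‖₁ + λ₂ ∑_i ‖∑_{j ≤ i} Θ_j‖₁`,
where `i(t)` is the block of `t`. -/
def objective {p : ℕ} (n b : ℕ) (lam₁ lam₂ : ℝ) (y : ℕ → Vec p) (Θ : ℕ → Vec p) : ℝ :=
  (1 / (n : ℝ)) * ∑ i ∈ Finset.Icc 1 (n / b),
      ∑ t ∈ Finset.Ico (blockEnd n b (i - 1)) (blockEnd n b i),
        ‖y t - ∑ j ∈ Finset.Icc 1 i, Θ j‖ ^ 2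
    + lam₁ * ∑ i ∈ Finset.Icc 1 (n / b), l1 (Θ i)
    + lam₂ * ∑ i ∈ Finset.Icc 1 (n / b), l1 (∑ j ∈ Finset.Icc 1 i, Θ j)

open Classical in
/-- The indices of the blocks that survive hard thresholding: `2 ≤ i ≤ k` and `‖Θ_i‖₂ > thr`. The
corresponding candidate change point is `r_{i-1}`. -/
def candidates {p : ℕ} (n b : ℕ) (thr : ℝ≥0∞) (Θ : ℕ → Vec p) : Finset ℕ :=
  (Finset.Icc 2 (n / b)).filter fun i => thr < ENNReal.ofReal ‖Θ i‖

/-- `J_1, …, J_m` is a partition of the index set `I` into nonempty sets of consecutive elements of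
`I`, in increasing order, such that each cluster `{r_{i-1} : i ∈ J_j}` of candidate change points
has diameter at most `b`. -/
structure IsPartition (n b : ℕ) (I : Finset ℕ) (m : ℕ) (J : ℕ → Finset ℕ) : Prop where
  nonempty : ∀ j ∈ Finset.Icc 1 m, (J j).Nonempty
  cover : ∀ i, i ∈ I ↔ ∃ j ∈ Finset.Icc 1 m, i ∈ J j
  increasing : ∀ j ∈ Finset.Icc 1 m, ∀ j' ∈ Finset.Icc 1 m, j < j' →
    ∀ i ∈ J j, ∀ i' ∈ J j', i < i'
  diam : ∀ j ∈ Finset.Icc 1 m, ∀ i ∈ J j, ∀ i' ∈ J j,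
    blockEnd n b (i' - 1) ≤ blockEnd n b (i - 1) + b

/-- A block clustering: a partition as above with the smallest possible number of clusters. -/
def IsClustering (n b : ℕ) (I : Finset ℕ) (m : ℕ) (J : ℕ → Finset ℕ) : Prop :=
  IsPartition n b I m J ∧ ∀ m' J', IsPartition n b I m' J' → m ≤ m'

/-- What the procedure returns: the lasso solution `Θ`, the number `m` of clusters, the clusters
`J_1, …, J_m` of block indices together with `J_0` and `J_{m+1}`, and the final estimates
`t_1, …, t_m` of the change points. -/
structure Output (p : ℕ) where
  Θ : ℕ → Vec p
  m : ℕ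
  J : ℕ → Finset ℕ
  cp : ℕ → ℕ

namespace Output

variable {p : ℕ} (o : Output p)

/-- `max J_j`. -/
def maxIdx (j : ℕ) : ℕ := sSup (o.J j : Set ℕ)

/-- `min J_j`. -/
def minIdx (j : ℕ) : ℕ := sInf (o.J j : Set ℕ)

/-- The estimate of the mean of the `j`-th segment, `j = 1, …, m + 1`:
the sum of `Θ_i` over `1 ≤ i ≤ ⌊(max J_{j-1} + min J_j) / 2⌋`. -/
def meanEst (j : ℕ) : Vec p := ∑ i ∈ Finset.Icc 1 ((o.maxIdx (j - 1) + o.minIdx j) / 2), o.Θ i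

/-- The estimate of the mean of the `j`-th segment after entrywise hard thresholding at `η`. -/
def meanThr (η : ℝ) (j : ℕ) : Vec p :=
  WithLp.toLp 2 fun h => if η < |o.meanEst j h| then o.meanEst j h else 0

/-- `min R_j`, where `R_j = {r_{i-1} : i ∈ J_j}`. -/
def minR (n b j : ℕ) : ℕ := blockEnd n b (o.minIdx j - 1)

/-- `max R_j`. -/
def maxR (n b j : ℕ) : ℕ := blockEnd n b (o.maxIdx j - 1)

/-- The search domain `(l_j, u_j)` of the exhaustive search. -/
def searchDomain (n b j : ℕ) : Finset ℕ :=
  if (o.J j).card = 1 then Finset.Ioo (o.minR n b j - b) (o.maxR n b j + b)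
  else Finset.Ioo (o.minR n b j) (o.maxR n b j)

/-- The loss of the exhaustive search in the `j`-th cluster, at the time `s`. -/
def loss (n b : ℕ) (y : ℕ → Vec p) (j s : ℕ) : ℝ :=
  ∑ t ∈ Finset.Ico (o.minR n b j - b) s, ‖y t - o.meanEst j‖ ^ 2
    + ∑ t ∈ Finset.Ico s (o.maxR n b j + b), ‖y t - o.meanEst (j + 1)‖ ^ 2

/-- `o` is an output of the procedure on the data `y_1, …, y_n`, with block size `b`,
regularization parameters `lam₁`, `lam₂` and hard threshold `thr`. If a search domain is empty
(which needs `b = 1`), the corresponding estimate is arbitrary. -/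
structure IsTBFL (n b : ℕ) (lam₁ lam₂ : ℝ) (thr : ℝ≥0∞) (y : ℕ → Vec p) : Prop where
  lasso : ∀ Θ' : ℕ → Vec p, objective n b lam₁ lam₂ y o.Θ ≤ objective n b lam₁ lam₂ y Θ'
  clustering : IsClustering n b (candidates n b thr o.Θ) o.m o.J
  J_first : o.J 0 = {1}
  J_last : o.J (o.m + 1) = {n / b}
  search : ∀ j ∈ Finset.Icc 1 o.m, ∀ s ∈ o.searchDomain n b j,
    o.cp j ∈ o.searchDomain n b j ∧ o.loss n b y j (o.cp j) ≤ o.loss n b y j s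

end Output

/-- `log (p ∨ n)`. -/
def logMax (p n : ℕ) : ℝ := Real.log (max (p : ℝ) (n : ℝ))

end TBFL

end

/-! In terms of the partial sums of `Θ`, the block fused lasso separates into one scalar fused lasso
per coordinate (`isFusedMin_coord`), whose signal is constant on blocks. Two deterministic facts
about that scalar problem carry the proof. Moving the signal on a single block shows that the
residuals of the block sum to at most `Λ₁ + Λ₂ / 2` in absolute value
(`IsFusedMin.abs_sum_residual_le`); since both penalties have the order `√(b L)` of the noise on a
block, the signal is within a multiple of `√(L / b)` of the mean on every block inside a segment. If
the mean of a coordinate vanishes on a segment and `Λ₂` dominates the noise, the signal is exactly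
zero on all blocks inside the segment, because setting it to zero costs at most two extra jumps
while the `Λ₂` gain grows with the number of blocks (`IsFusedMin.eq_zero_of_run`). Together these
give an `ℓ₂` error `ρ` of order `√(d L / b)` without false positives (`partialSum_estimates`).

The rest is geometry. `Θ i` is small unless block `i - 1` or `i` fails to lie inside one segment, so
the candidates form groups of one or two neighbouring indices, one nonempty group per change point.
The groups are far apart, hence the minimal clustering recovers them
(`IsClustering.eq_of_separated`), and the index used for each mean falls well inside its segment.
Comparing the search loss at its minimizer and at the true change point bounds the location error
(`card_mul_sq_le_of_loss_le`); the noise enters only through at most `2 * d` coordinates.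

All randomness is confined to the event `GoodNoise`, on which every interval sum of every coordinate
of the errors is controlled; sub-Gaussian tails and a union bound give its complement probability at
most `8 / n` (`measure_not_goodNoise_le`). -/

namespace TBFL

/-! ### Scalar fused lasso -/

/-- The objective of the fused lasso for a scalar signal `x` that is constant on blocks `B i`. -/
noncomputable def fusedObj (k : ℕ) (B : ℕ → Finset ℕ) (Λ₁ Λ₂ : ℝ) (y x : ℕ → ℝ) : ℝ :=
  ∑ i ∈ Finset.Icc 1 k, ∑ t ∈ B i, (y t - x i) ^ 2
    + Λ₁ * ∑ i ∈ Finset.Icc 1 k, |x i - x (i - 1)| + Λ₂ * ∑ i ∈ Finset.Icc 1 k, |x i|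

/-- `x` minimizes the scalar fused lasso objective among the signals with `x 0 = 0`. -/
def IsFusedMin (k : ℕ) (B : ℕ → Finset ℕ) (Λ₁ Λ₂ : ℝ) (y x : ℕ → ℝ) : Prop :=
  x 0 = 0 ∧ ∀ z : ℕ → ℝ, z 0 = 0 → fusedObj k B Λ₁ Λ₂ y x ≤ fusedObj k B Λ₁ Λ₂ y z

lemma fusedObj_neg (k : ℕ) (B : ℕ → Finset ℕ) (Λ₁ Λ₂ : ℝ) (y x : ℕ → ℝ) :
    fusedObj k B Λ₁ Λ₂ (fun t => -y t) (fun i => -x i) = fusedObj k B Λ₁ Λ₂ y x := by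
  unfold fusedObj
  have h1 : ∀ i t, (-y t - -x i) ^ 2 = (y t - x i) ^ 2 := fun i t => by ring
  have h2 : ∀ i, |-x i - -x (i - 1)| = |x i - x (i - 1)| := fun i => by
    rw [← abs_neg]; congr 1; ring
  simp only [h1, h2, abs_neg]

/-- The sign symmetry of the problem turns one-sided bounds on a minimizer into two-sided ones. -/
lemma IsFusedMin.neg {k : ℕ} {B : ℕ → Finset ℕ} {Λ₁ Λ₂ : ℝ} {y x : ℕ → ℝ}
    (h : IsFusedMin k B Λ₁ Λ₂ y x) :
    IsFusedMin k B Λ₁ Λ₂ (fun t => -y t) (fun i => -x i) := by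
  refine ⟨by simp [h.1], fun z hz => ?_⟩
  have := h.2 (fun i => -z i) (by simp [hz])
  rw [fusedObj_neg, ← fusedObj_neg k B Λ₁ Λ₂ _ z]
  simpa using this

/-- Stationarity of a single block: the residual sum is bounded by the penalties. -/
lemma IsFusedMin.abs_sum_residual_le {k : ℕ} {B : ℕ → Finset ℕ} {Λ₁ Λ₂ : ℝ} {y x : ℕ → ℝ}
    (h : IsFusedMin k B Λ₁ Λ₂ y x) (hΛ₁ : 0 ≤ Λ₁) (hΛ₂ : 0 ≤ Λ₂) {i : ℕ}
    (hi : i ∈ Finset.Icc 1 k) :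
    |∑ t ∈ B i, (y t - x i)| ≤ Λ₁ + Λ₂ / 2 := by
  set R := ∑ t ∈ B i, (y t - x i) with hR
  have hi1 : 1 ≤ i := (Finset.mem_Icc.1 hi).1
  -- Shifting the signal by `δ` on block `i` alone alters at most two increments and one absolute
  -- value.
  have key : ∀ δ : ℝ, 2 * δ * R ≤ (B i).card * δ ^ 2 + (2 * Λ₁ + Λ₂) * |δ| := by
    intro δ
    set z : ℕ → ℝ := fun j => x j + if j = i then δ else 0 with hz
    have hmin := h.2 z (by simp [hz, h.1]; omega)
    have hfid : ∑ j ∈ Finset.Icc 1 k, ∑ t ∈ B j, (y t - z j) ^ 2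
        = ∑ j ∈ Finset.Icc 1 k, ∑ t ∈ B j, (y t - x j) ^ 2
          + (-2 * δ * R + (B i).card * δ ^ 2) := by
      have : ∀ j, ∑ t ∈ B j, (y t - z j) ^ 2 = ∑ t ∈ B j, (y t - x j) ^ 2
          + if j = i then (-2 * δ * R + (B i).card * δ ^ 2) else 0 := by
        intro j
        by_cases hj : j = i
        · subst hj
          simp only [hz, if_true, hR]
          rw [Finset.mul_sum, add_comm (∑ t ∈ B j, -2 * δ * (y t - x j)), ← nsmul_eq_mul,
            ← Finset.sum_const, ← Finset.sum_add_distrib, ← Finset.sum_add_distrib]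
          exact Finset.sum_congr rfl fun t _ => by ring
        · simp [hz, hj]
      simp_rw [this]
      rw [Finset.sum_add_distrib, Finset.sum_ite_eq' _ i, if_pos hi]
    have hsum : ∑ j ∈ Finset.Icc 1 k, (if j = i then |δ| else 0) = |δ| := by
      rw [Finset.sum_ite_eq' _ i, if_pos hi]
    have hsum' : ∑ j ∈ Finset.Icc 1 k, (if j - 1 = i then |δ| else 0) ≤ |δ| := by
      calc ∑ j ∈ Finset.Icc 1 k, (if j - 1 = i then |δ| else 0)
          = ∑ j ∈ Finset.Icc 1 k, (if j = i + 1 then |δ| else 0) := by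
            refine Finset.sum_congr rfl fun j hj => ?_
            have := (Finset.mem_Icc.1 hj).1
            congr 1
            simp only [eq_iff_iff]
            omega
        _ ≤ |δ| := by
            rw [Finset.sum_ite_eq' _ (i + 1)]
            split_ifs <;> simp
    have habs : ∀ j, |z j - x j| ≤ if j = i then |δ| else 0 := by
      intro j; by_cases hj : j = i <;> simp [hz, hj]
    have htv : ∑ j ∈ Finset.Icc 1 k, |z j - z (j - 1)|
        ≤ ∑ j ∈ Finset.Icc 1 k, |x j - x (j - 1)| + 2 * |δ| := by
      have : ∀ j ∈ Finset.Icc 1 k, |z j - z (j - 1)| ≤ |x j - x (j - 1)|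
          + ((if j = i then |δ| else 0) + (if j - 1 = i then |δ| else 0)) := by
        intro j _
        have h1 := habs j
        have h2 := habs (j - 1)
        rw [abs_le] at h1 h2
        rw [abs_le]
        have h3 := abs_le.1 (le_refl |x j - x (j - 1)|)
        constructor <;> linarith [h1.1, h1.2, h2.1, h2.2, h3.1, h3.2]
      refine (Finset.sum_le_sum this).trans ?_
      rw [Finset.sum_add_distrib, Finset.sum_add_distrib]
      linarith
    have hl1 : ∑ j ∈ Finset.Icc 1 k, |z j| ≤ ∑ j ∈ Finset.Icc 1 k, |x j| + |δ| := by
      rw [← hsum, ← Finset.sum_add_distrib]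
      refine Finset.sum_le_sum fun j _ => ?_
      have h1 := habs j
      have := abs_sub_abs_le_abs_sub (z j) (x j)
      linarith
    unfold fusedObj at hmin
    rw [hfid] at hmin
    have e1 := mul_le_mul_of_nonneg_left htv hΛ₁
    have e2 := mul_le_mul_of_nonneg_left hl1 hΛ₂
    linarith
  have hcard : (0 : ℝ) ≤ (B i).card := Nat.cast_nonneg _
  refine le_of_forall_pos_le_add fun η hη => ?_
  -- A shift so small that the quadratic term, after division by `δ`, is at most `η`; both signs are
  -- used.
  set δ := η / ((B i).card + 1) with hδ
  have hδ0 : 0 < δ := by positivity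
  have hδη : (B i).card * δ ≤ η := by
    have : ((B i).card + 1) * δ = η := by rw [hδ]; field_simp
    nlinarith
  have k1 := key δ
  have k2 := key (-δ)
  rw [abs_neg] at k2
  rw [abs_of_pos hδ0] at k1 k2
  rw [abs_le]
  constructor
  · have : δ * (-(2 * R)) ≤ δ * ((B i).card * δ + (2 * Λ₁ + Λ₂)) := by nlinarith
    have := le_of_mul_le_mul_left this hδ0
    linarith
  · have : δ * (2 * R) ≤ δ * ((B i).card * δ + (2 * Λ₁ + Λ₂)) := by nlinarith
    have := le_of_mul_le_mul_left this hδ0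
    linarith

/-- On a long run of blocks where the data sums are small, the fused lasso is not positive. -/
lemma IsFusedMin.nonpos_of_run {k : ℕ} {B : ℕ → Finset ℕ} {Λ₁ Λ₂ : ℝ} {y x : ℕ → ℝ}
    (h : IsFusedMin k B Λ₁ Λ₂ y x) (hΛ₁ : 0 ≤ Λ₁) {a e : ℕ} (ha : 1 ≤ a) (he : e ≤ k)
    {N : ℝ} (hN : ∀ i ∈ Finset.Icc a e, |∑ t ∈ B i, y t| ≤ N) (hΛ₂ : 2 * N < Λ₂)
    (hlong : 2 * Λ₁ < (e + 1 - a : ℕ) * (Λ₂ - 2 * N)) {i : ℕ} (hi : i ∈ Finset.Icc a e) :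
    x i ≤ 0 := by
  -- The competitor `z = x - m` cuts off the positive part of `x` on the run and leaves `x`
  -- unchanged elsewhere.
  set m : ℕ → ℝ := fun j => if j ∈ Finset.Icc a e then max (x j) 0 else 0 with hm
  have hm0 : ∀ j, 0 ≤ m j := by
    intro j; simp only [hm]; split_ifs
    · exact le_max_right _ _
    · exact le_rfl
  set z : ℕ → ℝ := fun j => x j - m j with hz
  have ho : ∀ l, l ∉ Finset.Icc a e → m l = 0 := fun l hl => by simp only [hm]; rw [if_neg hl]
  have hmz : m 0 = 0 := ho 0 (by simp; omega)
  have hmin := h.2 z (by simp [hz, hmz, h.1])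
  obtain ⟨i₀, hi₀, hi₀min⟩ := Finset.exists_min_image (Finset.Icc a e) m ⟨i, hi⟩
  have hsub : Finset.Icc a e ⊆ Finset.Icc 1 k := Finset.Icc_subset_Icc ha he
  have hsplit : ∑ j ∈ Finset.Icc 1 k, m j = ∑ j ∈ Finset.Icc a e, m j := by
    symm
    exact Finset.sum_subset hsub fun j _ hj => ho j hj
  have hfid : ∑ j ∈ Finset.Icc 1 k, ∑ t ∈ B j, (y t - z j) ^ 2
      ≤ ∑ j ∈ Finset.Icc 1 k, ∑ t ∈ B j, (y t - x j) ^ 2 + 2 * N * ∑ j ∈ Finset.Icc 1 k, m j := by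
    rw [Finset.mul_sum, ← Finset.sum_add_distrib]
    refine Finset.sum_le_sum fun j _ => ?_
    by_cases hj : j ∈ Finset.Icc a e
    · have hmj : m j = max (x j) 0 := by simp only [hm]; rw [if_pos hj]
      have hprod : m j * x j = m j ^ 2 := by
        rw [hmj]
        rcases le_total (x j) 0 with hx | hx
        · rw [max_eq_right hx]; simp
        · rw [max_eq_left hx]; ring
      have : ∑ t ∈ B j, (y t - z j) ^ 2
          = ∑ t ∈ B j, (y t - x j) ^ 2 + (2 * m j * ∑ t ∈ B j, y t - (B j).card * m j ^ 2) := by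
        rw [← nsmul_eq_mul (B j).card, ← Finset.sum_const, Finset.mul_sum,
          ← Finset.sum_sub_distrib, ← Finset.sum_add_distrib]
        refine Finset.sum_congr rfl fun t _ => ?_
        simp only [hz]
        linear_combination (-2 : ℝ) * hprod
      rw [this]
      have h1 := (abs_le.1 (hN j hj)).2
      have h2 := mul_le_mul_of_nonneg_left h1 (hm0 j)
      have h3 : 0 ≤ ((B j).card : ℝ) * m j ^ 2 := mul_nonneg (Nat.cast_nonneg _) (sq_nonneg _)
      linarith
    · have hmj : m j = 0 := ho j hj
      simp [hz, hmj]
  have hl1 : ∑ j ∈ Finset.Icc 1 k, |z j| ≤ ∑ j ∈ Finset.Icc 1 k, |x j| - ∑ j ∈ Finset.Icc 1 k, m j := by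
    rw [← Finset.sum_sub_distrib]
    refine Finset.sum_le_sum fun j _ => ?_
    by_cases hj : j ∈ Finset.Icc a e
    · have hmj : m j = max (x j) 0 := by simp only [hm]; rw [if_pos hj]
      simp only [hz, hmj]
      rcases le_total (x j) 0 with hx | hx
      · rw [max_eq_right hx]; simp
      · rw [max_eq_left hx, abs_of_nonneg hx]; simp
    · have hmj : m j = 0 := ho j hj
      simp [hz, hmj]
  -- Inside the run, truncation lowers the variation by the variation of `m`; at each end it adds at
  -- most the end value of `m`. As `m` must descend from both end values to its minimum `m i₀`, the
  -- net increase is at most `2 * m i₀`. The potential `M` records this step by step: it follows `m`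
  -- up to `i₀` and its reflection in the level `m i₀` afterwards.
  set M : ℕ → ℝ := fun j => if j ≤ i₀ then m j else 2 * m i₀ - m j with hM
  have hi₀' := Finset.mem_Icc.1 hi₀
  have hstep : ∀ j ∈ Finset.Icc 1 k,
      |z j - z (j - 1)| ≤ |x j - x (j - 1)| + (M j - M (j - 1)) := by
    intro j hj
    have hj1 := (Finset.mem_Icc.1 hj).1
    have hgen : |z j - z (j - 1)| ≤ |x j - x (j - 1)| + (m j + m (j - 1)) := by
      have : z j - z (j - 1) = (x j - x (j - 1)) + (m (j - 1) - m j) := by simp only [hz]; ring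
      rw [this]
      refine (abs_add_le _ _).trans ?_
      gcongr
      rw [abs_le]; constructor <;> linarith [hm0 j, hm0 (j - 1)]
    have hin : j ∈ Finset.Icc a e → j - 1 ∈ Finset.Icc a e →
        |z j - z (j - 1)| ≤ |x j - x (j - 1)| - |m j - m (j - 1)| := by
      intro h1 h2
      have e1 : m j = max (x j) 0 := by simp only [hm]; rw [if_pos h1]
      have e2 : m (j - 1) = max (x (j - 1)) 0 := by simp only [hm]; rw [if_pos h2]
      simp only [hz, e1, e2]
      rcases le_total (x j) 0 with hx | hx <;> rcases le_total (x (j - 1)) 0 with hx' | hx'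
      · rw [max_eq_right hx, max_eq_right hx']; simp
      · rw [max_eq_right hx, max_eq_left hx', abs_of_nonpos (by linarith : x j - x (j-1) ≤ 0),
          abs_of_nonpos (by linarith), abs_of_nonpos (by linarith)]; linarith
      · rw [max_eq_left hx, max_eq_right hx', abs_of_nonneg (by linarith : 0 ≤ x j - x (j-1)),
          abs_of_nonneg (by linarith), abs_of_nonneg (by linarith)]; linarith
      · rw [max_eq_left hx, max_eq_left hx']; simp
    rcases lt_trichotomy j (i₀ + 1) with hlt | heq | hgt
    · have e1 : M j = m j := by simp only [hM]; rw [if_pos (by omega)]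
      have e2 : M (j - 1) = m (j - 1) := by simp only [hM]; rw [if_pos (by omega)]
      rw [e1, e2]
      by_cases h2 : j - 1 ∈ Finset.Icc a e
      · have h1 : j ∈ Finset.Icc a e := by rw [Finset.mem_Icc] at h2 ⊢; omega
        have := hin h1 h2
        have := neg_abs_le (m j - m (j - 1))
        linarith
      · rw [ho _ h2] at hgen ⊢; linarith
    · have e1 : M j = 2 * m i₀ - m j := by simp only [hM]; rw [if_neg (by omega)]
      have e2 : M (j - 1) = m i₀ := by
        simp only [hM]; rw [if_pos (by omega)]; congr 1; omega
      have e3 : m (j - 1) = m i₀ := by congr 1; omega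
      rw [e1, e2]
      by_cases h1 : j ∈ Finset.Icc a e
      · have := hin h1 (by rw [Finset.mem_Icc] at h1 ⊢; omega)
        have := le_abs_self (m j - m (j - 1))
        linarith
      · rw [ho _ h1] at hgen ⊢; linarith
    · have e1 : M j = 2 * m i₀ - m j := by simp only [hM]; rw [if_neg (by omega)]
      have e2 : M (j - 1) = 2 * m i₀ - m (j - 1) := by simp only [hM]; rw [if_neg (by omega)]
      rw [e1, e2]
      by_cases h1 : j ∈ Finset.Icc a e
      · have := hin h1 (by rw [Finset.mem_Icc] at h1 ⊢; omega)
        have := le_abs_self (m j - m (j - 1))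
        linarith
      · rw [ho _ h1] at hgen ⊢; linarith
  have htel : ∀ q : ℕ, ∑ j ∈ Finset.Icc 1 q, (M j - M (j - 1)) = M q - M 0 := by
    intro q
    induction q with
    | zero => simp
    | succ q ih => rw [Finset.sum_Icc_succ_top (by omega), ih]; simp
  have htv : ∑ j ∈ Finset.Icc 1 k, |z j - z (j - 1)|
      ≤ ∑ j ∈ Finset.Icc 1 k, |x j - x (j - 1)| + 2 * m i₀ := by
    refine (Finset.sum_le_sum hstep).trans ?_
    rw [Finset.sum_add_distrib, htel]
    have h0 : M 0 = 0 := by simp [hM, hmz]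
    have hk : M k ≤ 2 * m i₀ := by
      simp only [hM]; split_ifs with hc
      · have : k = i₀ := by omega
        rw [this]; linarith [hm0 i₀]
      · linarith [hm0 k]
    linarith
  have hmain : (Λ₂ - 2 * N) * ∑ j ∈ Finset.Icc a e, m j ≤ 2 * Λ₁ * m i₀ := by
    unfold fusedObj at hmin
    have hN0 : 0 ≤ N := (abs_nonneg _).trans (hN i hi)
    have e1 := mul_le_mul_of_nonneg_left htv hΛ₁
    have e2 := mul_le_mul_of_nonneg_left hl1 (by linarith : 0 ≤ Λ₂)
    rw [← hsplit]
    linarith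
  -- Every block of the run contributes at least `m i₀`, so on a long run the gain would exceed the
  -- cost unless `m i₀ = 0`; then the cost is zero and `m` vanishes.
  have hcount : ((e + 1 - a : ℕ) : ℝ) * m i₀ ≤ ∑ j ∈ Finset.Icc a e, m j := by
    rw [← Nat.card_Icc, ← nsmul_eq_mul, ← Finset.sum_const]
    exact Finset.sum_le_sum fun j hj => hi₀min j hj
  have hm0' : m i₀ = 0 := by
    by_contra hne
    have hpos : 0 < m i₀ := lt_of_le_of_ne (hm0 _) (Ne.symm hne)
    have h1 := mul_le_mul_of_nonneg_left hcount (by linarith : 0 ≤ Λ₂ - 2 * N)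
    have h2 := mul_lt_mul_of_pos_right hlong hpos
    linarith
  rw [hm0', mul_zero] at hmain
  have hle : ∑ j ∈ Finset.Icc a e, m j ≤ 0 := by
    by_contra hc
    have : 0 < (Λ₂ - 2 * N) * ∑ j ∈ Finset.Icc a e, m j :=
      mul_pos (by linarith) (lt_of_not_ge hc)
    linarith
  have : m i ≤ 0 := (Finset.single_le_sum (fun j _ => hm0 j) hi).trans hle
  have e1 : m i = max (x i) 0 := by simp only [hm]; rw [if_pos hi]
  rw [e1] at this
  exact (le_max_left _ _).trans this

/-- On a long run of blocks where the data sums are small, the fused lasso vanishes. -/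
lemma IsFusedMin.eq_zero_of_run {k : ℕ} {B : ℕ → Finset ℕ} {Λ₁ Λ₂ : ℝ} {y x : ℕ → ℝ}
    (h : IsFusedMin k B Λ₁ Λ₂ y x) (hΛ₁ : 0 ≤ Λ₁) {a e : ℕ} (ha : 1 ≤ a) (he : e ≤ k)
    {N : ℝ} (hN : ∀ i ∈ Finset.Icc a e, |∑ t ∈ B i, y t| ≤ N) (hΛ₂ : 2 * N < Λ₂)
    (hlong : 2 * Λ₁ < (e + 1 - a : ℕ) * (Λ₂ - 2 * N)) {i : ℕ} (hi : i ∈ Finset.Icc a e) :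
    x i = 0 := by
  refine le_antisymm (h.nonpos_of_run hΛ₁ ha he hN hΛ₂ hlong hi) ?_
  have := h.neg.nonpos_of_run hΛ₁ ha he (N := N)
    (fun j hj => by rw [Finset.sum_neg_distrib, abs_neg]; exact hN j hj) hΛ₂ hlong hi
  linarith

end TBFL

namespace TBFL

/-! ### Sub-Gaussian noise -/

/-- Isolates the linear term, which disappears in the expectation of a centred variable. -/
lemma exp_le_add_exp_sq (x : ℝ) : Real.exp x ≤ x + Real.exp (x ^ 2) := by
  have h2 := Real.add_one_le_exp (x ^ 2)
  by_cases h : |x| ≤ 1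
  · have := (abs_le.1 (Real.abs_exp_sub_one_sub_id_le h)).2
    linarith
  · rcases lt_abs.1 (not_le.1 h) with h1 | h1
    · have : Real.exp x ≤ Real.exp (x ^ 2) := Real.exp_le_exp.2 (by nlinarith)
      linarith
    · have : Real.exp x ≤ 1 := Real.exp_le_one_iff.2 (by linarith)
      nlinarith

variable {Ω : Type*} [MeasurableSpace Ω] {P : Measure Ω}

lemma eLpNorm_le_of_psi2Norm_le {X : Ω → ℝ} {σ : ℝ} (hX : psi2Norm P X ≤ ENNReal.ofReal σ)
    {q : ℝ} (hq : 1 ≤ q) : eLpNorm X (ENNReal.ofReal q) P ≤ ENNReal.ofReal (σ * √q) := by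
  have h1 : ENNReal.ofReal (q ^ (-(1 / 2) : ℝ)) * eLpNorm X (ENNReal.ofReal q) P
      ≤ ENNReal.ofReal σ :=
    (le_iSup (fun q : {q : ℝ // 1 ≤ q} =>
      ENNReal.ofReal ((q : ℝ) ^ (-(1 / 2) : ℝ)) * eLpNorm X (ENNReal.ofReal q) P) ⟨q, hq⟩).trans hX
  have hq0 : 0 < q := by linarith
  have h2 : √q * q ^ (-(1 / 2) : ℝ) = 1 := by
    rw [Real.sqrt_eq_rpow, ← Real.rpow_add hq0]; norm_num
  calc eLpNorm X (ENNReal.ofReal q) P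
      = ENNReal.ofReal (√q) *
          (ENNReal.ofReal (q ^ (-(1 / 2) : ℝ)) * eLpNorm X (ENNReal.ofReal q) P) := by
        rw [← mul_assoc, ← ENNReal.ofReal_mul (Real.sqrt_nonneg _), h2]; simp
    _ ≤ ENNReal.ofReal (√q) * ENNReal.ofReal σ := by gcongr
    _ = ENNReal.ofReal (σ * √q) := by
        rw [← ENNReal.ofReal_mul (Real.sqrt_nonneg _), mul_comm]

lemma lintegral_sq_pow_le {X : Ω → ℝ} {σ V : ℝ} (hσ : 0 ≤ σ) (hV : σ ^ 2 ≤ V)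
    (hX : psi2Norm P X ≤ ENNReal.ofReal σ) {k : ℕ} (hk : 1 ≤ k) :
    ∫⁻ w, ENNReal.ofReal ((X w ^ 2) ^ k) ∂P ≤ ENNReal.ofReal ((2 * k * V) ^ k) := by
  have hk' : (1 : ℝ) ≤ k := by exact_mod_cast hk
  have h := eLpNorm_le_of_psi2Norm_le hX (q := 2 * k) (by linarith)
  set r : NNReal := 2 * k with hr
  have hr0 : r ≠ 0 := by
    have : k ≠ 0 := by omega
    simp [hr, this]
  have hrq : ENNReal.ofReal (2 * k) = (r : ℝ≥0∞) := by
    rw [ENNReal.ofReal_eq_coe_nnreal (by positivity)]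
    congr 1
  have hrr : (r : ℝ) = ((2 * k : ℕ) : ℝ) := by simp [hr]
  rw [hrq] at h
  have h2 : eLpNorm X r P ^ (r : ℝ) = ∫⁻ w, ‖X w‖ₑ ^ (r : ℝ) ∂P := eLpNorm_nnreal_pow_eq_lintegral hr0
  have h3 : ∀ w, ENNReal.ofReal ((X w ^ 2) ^ k) = ‖X w‖ₑ ^ (r : ℝ) := by
    intro w
    rw [hrr, ENNReal.rpow_natCast, ← ofReal_norm, ← ENNReal.ofReal_pow (norm_nonneg _),
      Real.norm_eq_abs, pow_mul, sq_abs]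
  simp_rw [h3]
  rw [← h2, hrr, ENNReal.rpow_natCast]
  calc eLpNorm X r P ^ (2 * k) ≤ ENNReal.ofReal (σ * √(2 * k)) ^ (2 * k) := by gcongr
    _ = ENNReal.ofReal ((2 * k * σ ^ 2) ^ k) := by
        rw [← ENNReal.ofReal_pow (by positivity), pow_mul, mul_pow σ,
          Real.sq_sqrt (by positivity), mul_comm (σ ^ 2)]
    _ ≤ _ := by gcongr

/-- In the exponential series the `k`-th moment of `X ^ 2` is at most `(2 * k * V) ^ k`, and `k ^ k
/ k! ≤ e ^ k` leaves a geometric series of ratio `2 * e * V * θ`. -/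
lemma lintegral_exp_sq_le [IsProbabilityMeasure P] {X : Ω → ℝ} (hXm : Measurable X) {σ V : ℝ}
    (hσ : 0 ≤ σ) (hV : σ ^ 2 ≤ V) (hX : psi2Norm P X ≤ ENNReal.ofReal σ) {θ : ℝ} (hθ : 0 ≤ θ)
    (hθV : 2 * Real.exp 1 * V * θ < 1) :
    ∫⁻ w, ENNReal.ofReal (Real.exp (θ * X w ^ 2)) ∂P
      ≤ ENNReal.ofReal (1 - 2 * Real.exp 1 * V * θ)⁻¹ := by
  have hV0 : 0 ≤ V := (sq_nonneg _).trans hV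
  set a := 2 * Real.exp 1 * V * θ with ha
  have ha0 : 0 ≤ a := by positivity
  have hexp : ∀ w, ENNReal.ofReal (Real.exp (θ * X w ^ 2))
      = ∑' k : ℕ, ENNReal.ofReal ((θ * X w ^ 2) ^ k / k.factorial) := by
    intro w
    have hs := NormedSpace.expSeries_div_summable (𝔸 := ℝ) (θ * X w ^ 2)
    rw [← ENNReal.ofReal_tsum_of_nonneg (fun k => by positivity) hs,
      Real.exp_eq_exp_ℝ, NormedSpace.exp_eq_tsum_div]
  simp_rw [hexp]
  rw [lintegral_tsum (fun k => by fun_prop), ← tsum_geometric_of_lt_one ha0 hθV,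
    ENNReal.ofReal_tsum_of_nonneg (fun k => by positivity) (summable_geometric_of_lt_one ha0 hθV)]
  refine ENNReal.tsum_le_tsum fun k => ?_
  rcases Nat.eq_zero_or_pos k with rfl | hk
  · simp
  · have e1 : ∀ w, ENNReal.ofReal ((θ * X w ^ 2) ^ k / k.factorial)
        = ENNReal.ofReal (θ ^ k / k.factorial) * ENNReal.ofReal ((X w ^ 2) ^ k) := by
      intro w
      rw [← ENNReal.ofReal_mul (by positivity)]
      congr 1
      rw [mul_pow]; ring
    simp_rw [e1]
    rw [lintegral_const_mul _ (by fun_prop)]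
    calc _ ≤ ENNReal.ofReal (θ ^ k / k.factorial) * ENNReal.ofReal ((2 * k * V) ^ k) := by
          gcongr; exact lintegral_sq_pow_le hσ hV hX hk
      _ = ENNReal.ofReal ((2 * V * θ) ^ k * ((k : ℝ) ^ k / k.factorial)) := by
          rw [← ENNReal.ofReal_mul (by positivity)]
          congr 1
          simp only [mul_pow]; ring
      _ ≤ ENNReal.ofReal (a ^ k) := by
          gcongr
          calc (2 * V * θ) ^ k * ((k : ℝ) ^ k / k.factorial)
              ≤ (2 * V * θ) ^ k * Real.exp k := by
                gcongr; exact Real.pow_div_factorial_le_exp _ (Nat.cast_nonneg k) k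
            _ = a ^ k := by
                rw [ha, ← Real.exp_one_pow k, ← mul_pow]; ring

/-- The variance proxy of a random variable with `ψ₂` norm at most `√V`. -/
noncomputable def proxy (V : ℝ) : NNReal := (10 * Real.exp 1 * V).toNNReal

lemma hasSubgaussianMGF_of_psi2Norm_le [IsProbabilityMeasure P] {X : Ω → ℝ} (hXm : Measurable X)
    (hmean : ∫ w, X w ∂P = 0) {σ V : ℝ} (hσ : 0 ≤ σ) (hV : σ ^ 2 ≤ V) (hV0 : 0 < V)
    (hX : psi2Norm P X ≤ ENNReal.ofReal σ) : HasSubgaussianMGF X (proxy V) P := by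
  have he : 0 < Real.exp 1 := Real.exp_pos 1
  -- This makes the ratio of the geometric series equal to `1 / 2`.
  set θ : ℝ := (4 * Real.exp 1 * V)⁻¹ with hθ
  have hθ0 : 0 < θ := by positivity
  have hθV : 2 * Real.exp 1 * V * θ = 1 / 2 := by rw [hθ]; field_simp; norm_num
  have hproxy : (proxy V : ℝ) = 10 * Real.exp 1 * V := by
    rw [proxy, Real.coe_toNNReal _ (by positivity)]
  have hint : ∀ s, 0 ≤ s → s ≤ θ → Integrable (fun w => Real.exp (s * X w ^ 2)) P ∧
      ∫ w, Real.exp (s * X w ^ 2) ∂P ≤ (1 - 2 * Real.exp 1 * V * s)⁻¹ := by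
    intro s hs0 hs
    have hsV : 2 * Real.exp 1 * V * s ≤ 1 / 2 := by
      rw [← hθV]; gcongr
    have hl := lintegral_exp_sq_le hXm hσ hV hX hs0 (by linarith)
    have hmeas : Measurable fun w => Real.exp (s * X w ^ 2) := by fun_prop
    constructor
    · refine ⟨hmeas.aestronglyMeasurable, ?_⟩
      rw [hasFiniteIntegral_iff_ofReal (Eventually.of_forall fun w => (Real.exp_pos _).le)]
      exact hl.trans_lt ENNReal.ofReal_lt_top
    · rw [integral_eq_lintegral_of_nonneg_ae (Eventually.of_forall fun w => (Real.exp_pos _).le)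
        hmeas.aestronglyMeasurable]
      refine ENNReal.toReal_le_of_le_ofReal ?_ hl
      exact inv_nonneg.2 (by linarith)
  have hXint : Integrable X P := by
    refine memLp_one_iff_integrable.1 ⟨hXm.aestronglyMeasurable, ?_⟩
    have := eLpNorm_le_of_psi2Norm_le hX (q := 1) le_rfl
    rw [ENNReal.ofReal_one] at this
    exact this.trans_lt ENNReal.ofReal_lt_top
  have hbig : ∀ s x : ℝ, Real.exp (s * x) ≤ Real.exp (s ^ 2 / (4 * θ)) * Real.exp (θ * x ^ 2) := by
    intro s x
    rw [← Real.exp_add]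
    refine Real.exp_le_exp.2 ?_
    have : s ^ 2 / (4 * θ) + θ * x ^ 2 - s * x = (s - 2 * θ * x) ^ 2 / (4 * θ) := by
      field_simp; ring
    have h2 : 0 ≤ (s - 2 * θ * x) ^ 2 / (4 * θ) := by positivity
    linarith
  refine ⟨fun s => ?_, fun s => ?_⟩
  · refine ((hint θ hθ0.le le_rfl).1.const_mul (Real.exp (s ^ 2 / (4 * θ)))).mono'
      (by fun_prop) (Eventually.of_forall fun w => ?_)
    rw [Real.norm_eq_abs, abs_of_pos (Real.exp_pos _)]
    exact hbig s (X w)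
  · rw [hproxy, mgf]
    -- For small `s` the mean-zero property gives the exponent `4 * e * V * s ^ 2`. For large `s`,
    -- completing the square gives `2 * exp (s ^ 2 / (4 * θ))`, and the factor `2` is absorbed by
    -- `exp (s ^ 2 / θ)`; the total `5 * e * V * s ^ 2` is what fixes the constant `10` in `proxy`.
    rcases le_total (s ^ 2) θ with hs | hs
    · have ⟨i1, i2⟩ := hint (s ^ 2) (sq_nonneg s) hs
      have hle : ∀ w, Real.exp (s * X w) ≤ s * X w + Real.exp (s ^ 2 * X w ^ 2) := fun w => by
        have := exp_le_add_exp_sq (s * X w)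
        rwa [mul_pow] at this
      have : ∫ w, Real.exp (s * X w) ∂P ≤ ∫ w, (s * X w + Real.exp (s ^ 2 * X w ^ 2)) ∂P :=
        integral_mono_of_nonneg (Eventually.of_forall fun w => (Real.exp_pos _).le)
          ((hXint.const_mul s).add i1) (Eventually.of_forall hle)
      rw [integral_add (hXint.const_mul s) i1, integral_const_mul, hmean, mul_zero, zero_add] at this
      set u := 2 * Real.exp 1 * V * s ^ 2 with hu
      have hu0 : 0 ≤ u := by positivity
      have hu1 : u ≤ 1 / 2 := by
        rw [← hθV, hu]; gcongr
      calc _ ≤ (1 - u)⁻¹ := this.trans i2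
        _ ≤ 1 + 2 * u := by
            rw [inv_le_iff_one_le_mul₀ (by linarith)]; nlinarith
        _ ≤ Real.exp (2 * u) := by linarith [Real.add_one_le_exp (2 * u)]
        _ ≤ _ := Real.exp_le_exp.2 (by rw [hu]; nlinarith [show 0 ≤ Real.exp 1 * V * s ^ 2 by positivity])
    · have ⟨i1, i2⟩ := hint θ hθ0.le le_rfl
      rw [hθV] at i2
      have : ∫ w, Real.exp (s * X w) ∂P
          ≤ ∫ w, Real.exp (s ^ 2 / (4 * θ)) * Real.exp (θ * X w ^ 2) ∂P :=
        integral_mono_of_nonneg (Eventually.of_forall fun w => (Real.exp_pos _).le)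
          (i1.const_mul _) (Eventually.of_forall fun w => hbig s (X w))
      rw [integral_const_mul] at this
      have h2 : (2 : ℝ) ≤ Real.exp (s ^ 2 / θ) := by
        have h1 : 1 ≤ s ^ 2 / θ := by rwa [le_div_iff₀ hθ0, one_mul]
        linarith [Real.add_one_le_exp (s ^ 2 / θ)]
      calc _ ≤ Real.exp (s ^ 2 / (4 * θ)) * Real.exp (s ^ 2 / θ) := by
            refine this.trans ?_
            gcongr
            refine i2.trans (le_trans ?_ h2)
            norm_num
        _ = _ := by
            rw [← Real.exp_add]
            congr 1
            rw [hθ]; field_simp; ring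

lemma IsSubGaussianVector.hasSubgaussianMGF [IsProbabilityMeasure P] {p : ℕ} {X : Ω → Vec p}
    {S : Matrix (Fin p) (Fin p) ℝ} {σ V : ℝ} (h : IsSubGaussianVector P X S σ) (hσ : 0 ≤ σ)
    (hV : σ ^ 2 ≤ V) (hV0 : 0 < V) (l : Fin p) :
    HasSubgaussianMGF (fun w => X w l) (proxy V) P := by
  refine hasSubgaussianMGF_of_psi2Norm_le ?_ (h.mean_zero l) hσ hV hV0 ?_
  · have := h.measurable
    fun_prop
  · have := h.psi2 (EuclideanSpace.single l 1) (by simp)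
    simpa [EuclideanSpace.inner_single_left] using this

/-- The event that all partial sums of the errors obey the law of large numbers up to a
logarithmic factor. -/
def GoodNoise {p : ℕ} (n : ℕ) (τ L : ℝ) (e : ℕ → Vec p) : Prop :=
  ∀ s u : ℕ, 1 ≤ s → s ≤ u → u ≤ n + 1 → ∀ h : Fin p,
    |∑ t ∈ Finset.Ico s u, e t h| ≤ τ * √((u - s : ℕ) * L)

/-- The Chernoff bound has exponent `τ ^ 2 * L / (2 * c)`, which `8 * c ≤ τ ^ 2` makes at least `4 *
L`; the resulting fourth power of `p ∨ n` pays for the union bound. -/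
lemma measure_abs_sum_gt_le [IsProbabilityMeasure P] {n : ℕ} {X : ℕ → Ω → ℝ}
    (hind : iIndepFun (fun t : Finset.Icc 1 n => X t) P) {c : NNReal}
    (hX : ∀ t ∈ Finset.Icc 1 n, HasSubgaussianMGF (X t) c P) (hc : 0 < c)
    {s u : ℕ} (hs : 1 ≤ s) (hsu : s ≤ u) (hu : u ≤ n + 1) {L τ : ℝ} (hL : 0 ≤ L) (hτ : 0 ≤ τ)
    (hτc : 8 * c ≤ τ ^ 2) :
    P {w | τ * √((u - s : ℕ) * L) < |∑ t ∈ Finset.Ico s u, X t w|}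
      ≤ ENNReal.ofReal (2 * Real.exp (-(4 * L))) := by
  classical
  rcases Nat.eq_or_lt_of_le hsu with rfl | hlt
  · simp
  set N : ℝ := ((u - s : ℕ) : ℝ) with hN
  have hN0 : 0 < N := by rw [hN]; exact_mod_cast (by omega : 0 < u - s)
  let A : Finset (Finset.Icc 1 n) := Finset.univ.filter fun t => (t : ℕ) ∈ Finset.Ico s u
  have hAsum : ∀ w, ∑ t ∈ A, X t w = ∑ t ∈ Finset.Ico s u, X t w := by
    intro w
    refine Finset.sum_bij (fun t _ => (t : ℕ)) ?_ ?_ ?_ ?_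
    · intro t ht; exact (Finset.mem_filter.1 ht).2
    · intro t _ t' _ h; exact Subtype.ext h
    · intro t ht
      have h' := Finset.mem_Ico.1 ht
      exact ⟨⟨t, Finset.mem_Icc.2 ⟨by omega, by omega⟩⟩, Finset.mem_filter.2 ⟨Finset.mem_univ _, ht⟩, rfl⟩
    · intro t _; rfl
  have hAcard : (A.card : ℝ) = N := by
    have : A.card = (Finset.Ico s u).card := by
      refine Finset.card_bij (fun t _ => (t : ℕ)) ?_ ?_ ?_
      · intro t ht; exact (Finset.mem_filter.1 ht).2
      · intro t _ t' _ h; exact Subtype.ext h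
      · intro t ht
        have h' := Finset.mem_Ico.1 ht
        exact ⟨⟨t, Finset.mem_Icc.2 ⟨by omega, by omega⟩⟩,
          Finset.mem_filter.2 ⟨Finset.mem_univ _, ht⟩, rfl⟩
    rw [this, Nat.card_Ico]
  have hsub : HasSubgaussianMGF (fun w => ∑ t ∈ A, X t w) (∑ t ∈ A, c) P :=
    HasSubgaussianMGF.sum_of_iIndepFun hind fun t _ => hX t t.2
  have hexp : ∀ Y : Ω → ℝ, HasSubgaussianMGF Y (∑ t ∈ A, c) P →
      P {w | τ * √(N * L) ≤ Y w} ≤ ENNReal.ofReal (Real.exp (-(4 * L))) := by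
    intro Y hY
    have h1 := hY.measure_ge_le (ε := τ * √(N * L)) (by positivity)
    rw [← ofReal_measureReal]
    refine ENNReal.ofReal_le_ofReal (h1.trans (Real.exp_le_exp.2 ?_))
    have h2 : ((∑ t ∈ A, c : NNReal) : ℝ) = N * c := by
      rw [← hAcard]; simp
    have hc' : (0 : ℝ) < c := by exact_mod_cast hc
    rw [h2, mul_pow, Real.sq_sqrt (by positivity), neg_div, neg_le_neg_iff,
      le_div_iff₀ (by positivity)]
    have := mul_le_mul_of_nonneg_right hτc (by positivity : 0 ≤ N * L)
    linarith
  have hcover : {w | τ * √(N * L) < |∑ t ∈ Finset.Ico s u, X t w|}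
      ⊆ {w | τ * √(N * L) ≤ ∑ t ∈ A, X t w} ∪ {w | τ * √(N * L) ≤ (-fun w => ∑ t ∈ A, X t w) w} := by
    intro w hw
    simp only [Set.mem_ofPred_eq, Set.mem_union, Pi.neg_apply, hAsum] at hw ⊢
    rcases lt_abs.1 hw with h | h
    · exact Or.inl h.le
    · exact Or.inr h.le
  refine (measure_mono hcover).trans ((measure_union_le _ _).trans ?_)
  refine (add_le_add (hexp _ hsub) (hexp _ hsub.neg)).trans ?_
  rw [← ENNReal.ofReal_add (Real.exp_pos _).le (Real.exp_pos _).le, two_mul]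

lemma measure_not_goodNoise_le [IsProbabilityMeasure P] {p n : ℕ} (hn : 1 ≤ n) {ε : ℕ → Ω → Vec p}
    (hind : iIndepFun (fun t : Finset.Icc 1 n => ε t) P) {c : NNReal}
    (hε : ∀ t ∈ Finset.Icc 1 n, ∀ h, HasSubgaussianMGF (fun w => ε t w h) c P) (hc : 0 < c)
    {τ : ℝ} (hτ : 0 ≤ τ) (hτc : 8 * c ≤ τ ^ 2) :
    P {w | ¬ GoodNoise n τ (logMax p n) (fun t => ε t w)} ≤ ENNReal.ofReal (8 / n) := by
  set L := logMax p n with hL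
  have hn0 : (0 : ℝ) < n := by exact_mod_cast hn
  have hmax : (0 : ℝ) < max (p : ℝ) n := lt_max_of_lt_right hn0
  have hL0 : 0 ≤ L := by
    refine Real.log_nonneg (le_max_of_le_right ?_)
    exact_mod_cast hn
  -- Both end points are shifted down by one, so that they range over `0, …, n`.
  let I : Finset ((ℕ × ℕ) × Fin p) :=
    ((Finset.range (n + 1) ×ˢ Finset.range (n + 1)) ×ˢ Finset.univ)
  let E : (ℕ × ℕ) × Fin p → Set Ω := fun i =>
    {w | i.1.1 ≤ i.1.2 ∧ τ * √((i.1.2 + 1 - (i.1.1 + 1) : ℕ) * L)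
      < |∑ t ∈ Finset.Ico (i.1.1 + 1) (i.1.2 + 1), ε t w i.2|}
  have hcover : {w | ¬ GoodNoise n τ L (fun t => ε t w)} ⊆ ⋃ i ∈ I, E i := by
    intro w hw
    simp only [Set.mem_ofPred_eq, GoodNoise, not_forall, not_le] at hw
    obtain ⟨s, u, hs, hsu, hu, h, hlt⟩ := hw
    simp only [Set.mem_iUnion]
    refine ⟨((s - 1, u - 1), h), ?_, ?_⟩
    · simp only [I, Finset.mem_product, Finset.mem_range, Finset.mem_univ, and_true]
      omega
    · simp only [E, Set.mem_ofPred_eq]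
      rw [Nat.sub_add_cancel hs, Nat.sub_add_cancel (hs.trans hsu)]
      exact ⟨by omega, hlt⟩
  have hE : ∀ i ∈ I, P (E i) ≤ ENNReal.ofReal (2 * Real.exp (-(4 * L))) := by
    rintro ⟨⟨s, u⟩, h⟩ hi
    simp only [I, Finset.mem_product, Finset.mem_range, Finset.mem_univ, and_true] at hi
    by_cases hsu : s ≤ u
    · have hind' : iIndepFun (fun t : Finset.Icc 1 n => (fun w => ε t w h)) P :=
        hind.comp (fun _ v => v h) (fun _ => by fun_prop)
      have := measure_abs_sum_gt_le (X := fun t w => ε t w h) hind' (fun t ht => hε t ht h) hc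
        (s := s + 1) (u := u + 1) (by omega) (by omega) (by omega) hL0 hτ hτc
      refine le_trans (measure_mono ?_) this
      intro w hw
      exact hw.2
    · have : E ((s, u), h) = ∅ := by
        ext w; simp [E, hsu]
      rw [this]; simp
  refine (measure_mono hcover).trans ((measure_biUnion_finset_le _ _).trans ?_)
  refine (Finset.sum_le_sum hE).trans ?_
  rw [Finset.sum_const, ← ENNReal.ofReal_nsmul]
  refine ENNReal.ofReal_le_ofReal ?_
  have hcard : (I.card : ℝ) = (n + 1) * (n + 1) * p := by
    simp [I, Finset.card_product]
  rw [nsmul_eq_mul, hcard]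
  have hexpL : Real.exp L = max (p : ℝ) n := Real.exp_log hmax
  set m := max (p : ℝ) n with hm
  have h4 : Real.exp (-(4 * L)) = (m ^ 4)⁻¹ := by
    rw [Real.exp_neg, ← hexpL, ← Real.exp_nat_mul]; norm_num
  have hpm : (p : ℝ) ≤ m := le_max_left _ _
  have hnm : (n : ℝ) ≤ m := le_max_right _ _
  have hn1 : (1 : ℝ) ≤ n := by exact_mod_cast hn
  rw [h4]
  -- Two end points and one coordinate cost three powers of `m = p ∨ n` against the four in the
  -- tail.
  calc ((n : ℝ) + 1) * (n + 1) * p * (2 * (m ^ 4)⁻¹)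
      ≤ (2 * m) * (2 * m) * m * (2 * (m ^ 4)⁻¹) := by
        gcongr <;> linarith
    _ = 8 / m := by field_simp; norm_num
    _ ≤ 8 / n := by gcongr

end TBFL

namespace TBFL

/-! ### The block fused lasso on blocks inside a segment -/

/-- The times of block `i`. -/
def block (n b i : ℕ) : Finset ℕ := Finset.Ico (blockEnd n b (i - 1)) (blockEnd n b i)

/-- The squared Euclidean norm and the `ℓ₁` norm are sums over coordinates, and `Θ i` is the
increment of the partial sums, which start from the empty sum at `0`. -/
lemma mul_objective_eq {p n b : ℕ} (hn : 0 < n) (lam₁ lam₂ : ℝ) (y Θ : ℕ → Vec p) :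
    n * objective n b lam₁ lam₂ y Θ = ∑ h, fusedObj (n / b) (block n b) (n * lam₁) (n * lam₂)
      (fun t => y t h) (fun i => (∑ j ∈ Finset.Icc 1 i, Θ j) h) := by
  have hn' : (n : ℝ) ≠ 0 := by exact_mod_cast hn.ne'
  have e1 : ∀ i ∈ Finset.Icc 1 (n / b),
      l1 (Θ i) = ∑ h, |(∑ j ∈ Finset.Icc 1 i, Θ j) h - (∑ j ∈ Finset.Icc 1 (i - 1), Θ j) h| := by
    intro i hi
    obtain ⟨i, rfl⟩ := Nat.exists_eq_add_of_le' (Finset.mem_Icc.1 hi).1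
    unfold l1
    refine Finset.sum_congr rfl fun h _ => ?_
    rw [Finset.sum_Icc_succ_top (by omega)]
    simp
  unfold objective fusedObj
  rw [Finset.sum_congr rfl e1]
  simp only [EuclideanSpace.real_norm_sq_eq, l1]
  rw [Finset.sum_add_distrib, Finset.sum_add_distrib, ← Finset.mul_sum, ← Finset.mul_sum,
    Finset.sum_comm (s := Finset.univ), Finset.sum_comm (s := Finset.univ),
    Finset.sum_comm (s := Finset.univ)]
  have e2 : ∀ i, ∑ h : Fin p, ∑ t ∈ block n b i, (y t h - (∑ j ∈ Finset.Icc 1 i, Θ j) h) ^ 2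
      = ∑ t ∈ Finset.Ico (blockEnd n b (i - 1)) (blockEnd n b i),
        ∑ h : Fin p, (y t - ∑ j ∈ Finset.Icc 1 i, Θ j) h ^ 2 := by
    intro i
    rw [Finset.sum_comm]
    rfl
  simp only [e2]
  field_simp

/-- The block fused lasso decouples into scalar problems, one for each coordinate. -/
lemma isFusedMin_coord {p n b : ℕ} (hn : 0 < n) {lam₁ lam₂ : ℝ} {y Θ : ℕ → Vec p}
    (hΘ : ∀ Θ' : ℕ → Vec p, objective n b lam₁ lam₂ y Θ ≤ objective n b lam₁ lam₂ y Θ')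
    (h : Fin p) :
    IsFusedMin (n / b) (block n b) (n * lam₁) (n * lam₂) (fun t => y t h)
      (fun i => (∑ j ∈ Finset.Icc 1 i, Θ j) h) := by
  refine ⟨by simp, fun z hz => ?_⟩
  -- Only coordinate `h` is replaced, by the increments of `z`; the other coordinates cancel in the
  -- comparison.
  set Θ' : ℕ → Vec p := fun i =>
    WithLp.toLp 2 fun l => if l = h then z i - z (i - 1) else Θ i l with hΘ'
  have hn' : (0 : ℝ) ≤ n := Nat.cast_nonneg n
  have hmin := mul_le_mul_of_nonneg_left (hΘ Θ') hn'
  rw [mul_objective_eq hn, mul_objective_eq hn,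
    ← Finset.add_sum_erase _ _ (Finset.mem_univ h),
    ← Finset.add_sum_erase (a := h) _ _ (Finset.mem_univ h)] at hmin
  have hz' : (fun i => (∑ j ∈ Finset.Icc 1 i, Θ' j) h) = z := by
    funext i
    induction i with
    | zero => simp [hz]
    | succ i ih =>
      rw [Finset.sum_Icc_succ_top (by omega)]
      simp only [PiLp.add_apply, ih]
      simp [hΘ']
  have hother : ∀ l ∈ Finset.univ.erase h,
      fusedObj (n / b) (block n b) (n * lam₁) (n * lam₂) (fun t => y t l)
        (fun i => (∑ j ∈ Finset.Icc 1 i, Θ' j) l)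
      = fusedObj (n / b) (block n b) (n * lam₁) (n * lam₂) (fun t => y t l)
        (fun i => (∑ j ∈ Finset.Icc 1 i, Θ j) l) := by
    intro l hl
    have hne := (Finset.mem_erase.1 hl).1
    congr 1
    funext i
    simp [hΘ', hne]
  rw [Finset.sum_congr rfl hother, hz'] at hmin
  linarith

/-! ### Geometry of the blocks -/

lemma blockEnd_pred {n b i : ℕ} (hi : i ∈ Finset.Icc 1 (n / b)) :
    blockEnd n b (i - 1) = 1 + (i - 1) * b := by
  rw [Finset.mem_Icc] at hi
  rw [blockEnd, if_pos (by omega)]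

/-- The last block absorbs the remainder of `n` modulo `b`, so its length may approach `2 * b`. -/
lemma blockEnd_bounds {n b i : ℕ} (hb : 0 < b) (hi : i ∈ Finset.Icc 1 (n / b)) :
    blockEnd n b (i - 1) + b ≤ blockEnd n b i ∧ blockEnd n b i ≤ blockEnd n b (i - 1) + 2 * b ∧
      blockEnd n b i ≤ n + 1 := by
  rw [blockEnd_pred hi]
  have hi' := Finset.mem_Icc.1 hi
  obtain ⟨i, rfl⟩ := Nat.exists_eq_add_of_le' hi'.1
  have h1 : (n / b) * b ≤ n := Nat.div_mul_le_self n b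
  have h2 : n < (n / b + 1) * b := Nat.lt_mul_of_div_lt (Nat.lt_succ_self _) hb
  have h3 : (i + 1) * b ≤ (n / b) * b := Nat.mul_le_mul_right b hi'.2
  rw [blockEnd]
  simp only [Nat.add_sub_cancel, Nat.add_mul, Nat.one_mul] at *
  split_ifs with hlt
  · constructor
    · omega
    constructor <;> omega
  · have : i + 1 = n / b := by omega
    rw [← this] at h1 h2
    simp only [Nat.add_mul, Nat.one_mul] at *
    refine ⟨?_, ?_, ?_⟩ <;> omega

/-- Block `i` lies inside the time interval `[T, T')`. -/
def InnerBlock (n b T T' i : ℕ) : Prop :=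
  i ∈ Finset.Icc 1 (n / b) ∧ T ≤ 1 + (i - 1) * b ∧ 1 + i * b ≤ T'

/-- `InnerBlock` uses the nominal end `1 + i * b`, which the last block can exceed. The alternative
`hT'` excludes the last block from any segment that does not reach the end of the sample. -/
lemma InnerBlock.subset {n b T T' i : ℕ} (h : InnerBlock n b T T' i) (hb : 0 < b)
    (hT' : T' = n + 1 ∨ T' + b ≤ n + 1) :
    T ≤ blockEnd n b (i - 1) ∧ blockEnd n b i ≤ T' := by
  obtain ⟨hi, h1, h2⟩ := h
  rw [blockEnd_pred hi]
  refine ⟨h1, ?_⟩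
  rw [blockEnd]
  split_ifs with hlt
  · exact h2
  · rcases hT' with h | h
    · exact h.ge
    · exfalso
      have hi' : i = n / b := by have := (Finset.mem_Icc.1 hi).2; omega
      have h3 : n < (n / b + 1) * b := Nat.lt_mul_of_div_lt (Nat.lt_succ_self _) hb
      rw [← hi', Nat.add_mul, Nat.one_mul] at h3
      omega

/-! ### One coordinate on one segment -/

section coordinate

variable {n b T T' : ℕ} {C₁ C₂ τ L μ : ℝ} {y e x : ℕ → ℝ}

lemma abs_block_noise_le (hb : 0 < b) (hT : 1 ≤ T) (hT' : T' = n + 1 ∨ T' + b ≤ n + 1)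
    (hτ : 0 ≤ τ) (hL : 0 ≤ L)
    (he : ∀ s u : ℕ, 1 ≤ s → s ≤ u → u ≤ n + 1 →
      |∑ t ∈ Finset.Ico s u, e t| ≤ τ * √((u - s : ℕ) * L))
    {i : ℕ} (hi : InnerBlock n b T T' i) :
    |∑ t ∈ block n b i, e t| ≤ 2 * τ * √(b * L) := by
  obtain ⟨h1, h2, h3⟩ := blockEnd_bounds hb hi.1
  obtain ⟨h4, h5⟩ := hi.subset hb hT'
  refine (he _ _ (by omega) (by omega) h3).trans ?_
  have h6 : (((blockEnd n b i - blockEnd n b (i - 1) : ℕ) : ℝ)) ≤ 2 * b := by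
    exact_mod_cast (by omega : blockEnd n b i - blockEnd n b (i - 1) ≤ 2 * b)
  have h7 : √(((blockEnd n b i - blockEnd n b (i - 1) : ℕ) : ℝ) * L) ≤ 2 * √(b * L) := by
    rw [Real.sqrt_le_left (by positivity), mul_pow, Real.sq_sqrt (by positivity)]
    nlinarith [mul_le_mul_of_nonneg_right h6 hL, show (0 : ℝ) ≤ b * L by positivity]
  nlinarith

/-- The block length times `μ - x i` is the residual sum minus the noise sum. Stationarity
contributes `C₁ + C₂ / 2`, the noise `2 * τ`, and the block has at least `b` times. -/
lemma abs_sub_mean_le (hb : 0 < b) (hT : 1 ≤ T) (hT' : T' = n + 1 ∨ T' + b ≤ n + 1)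
    (hτ : 0 ≤ τ) (hL : 0 ≤ L) (hC₁ : 0 ≤ C₁) (hC₂ : 0 ≤ C₂)
    (he : ∀ s u : ℕ, 1 ≤ s → s ≤ u → u ≤ n + 1 →
      |∑ t ∈ Finset.Ico s u, e t| ≤ τ * √((u - s : ℕ) * L))
    (hy : ∀ t, T ≤ t → t < T' → y t = μ + e t)
    (hx : IsFusedMin (n / b) (block n b) (C₁ * √(b * L)) (C₂ * √(b * L)) y x)
    {i : ℕ} (hi : InnerBlock n b T T' i) :
    |x i - μ| ≤ (C₁ + C₂ / 2 + 2 * τ) * √(L / b) := by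
  have hb' : (0 : ℝ) < b := by exact_mod_cast hb
  obtain ⟨h1, h2, h3⟩ := blockEnd_bounds hb hi.1
  obtain ⟨h4, h5⟩ := hi.subset hb hT'
  have hr := hx.abs_sum_residual_le (by positivity) (by positivity) hi.1
  have hnoise := abs_block_noise_le hb hT hT' hτ hL he hi
  set N : ℝ := ((block n b i).card : ℝ) with hN
  have hNb : (b : ℝ) ≤ N := by
    rw [hN, block, Nat.card_Ico]; exact_mod_cast (by omega : b ≤ _)
  have hsum : ∑ t ∈ block n b i, (y t - x i) = N * (μ - x i) + ∑ t ∈ block n b i, e t := by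
    have : ∀ t ∈ block n b i, y t - x i = (μ - x i) + e t := by
      intro t ht
      rw [block, Finset.mem_Ico] at ht
      rw [hy t (by omega) (by omega)]; ring
    rw [Finset.sum_congr rfl this, Finset.sum_add_distrib, Finset.sum_const, nsmul_eq_mul]
  have hsq : √(b * L) = b * √(L / b) := by
    rw [show (b : ℝ) * L = b ^ 2 * (L / b) by field_simp, Real.sqrt_mul (by positivity),
      Real.sqrt_sq hb'.le]
  have h6 : N * |x i - μ| ≤ (C₁ + C₂ / 2 + 2 * τ) * √(b * L) := by
    have e1 : N * (μ - x i) = ∑ t ∈ block n b i, (y t - x i) - ∑ t ∈ block n b i, e t := by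
      rw [hsum]; ring
    have e2 : N * |x i - μ| = |N * (μ - x i)| := by
      rw [abs_mul, abs_of_nonneg (hb'.le.trans hNb), abs_sub_comm]
    rw [e2, e1]
    refine (abs_sub _ _).trans ?_
    linarith
  have h7 : b * |x i - μ| ≤ b * ((C₁ + C₂ / 2 + 2 * τ) * √(L / b)) := by
    rw [hsq] at h6
    have := mul_le_mul_of_nonneg_right hNb (abs_nonneg (x i - μ))
    linarith
  exact le_of_mul_le_mul_left h7 hb'

lemma eq_zero_of_mean_eq_zero (hb : 0 < b) (hT : 1 ≤ T) (hT' : T' = n + 1 ∨ T' + b ≤ n + 1)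
    (hτ : 0 ≤ τ) (hL : 0 < L) (hC₁ : 0 ≤ C₁) (hC₂ : 4 * τ < C₂)
    (he : ∀ s u : ℕ, 1 ≤ s → s ≤ u → u ≤ n + 1 →
      |∑ t ∈ Finset.Ico s u, e t| ≤ τ * √((u - s : ℕ) * L))
    (hy : ∀ t, T ≤ t → t < T' → y t = e t)
    (hx : IsFusedMin (n / b) (block n b) (C₁ * √(b * L)) (C₂ * √(b * L)) y x)
    {N₀ : ℕ} (hN₀ : 2 * C₁ < N₀ * (C₂ - 4 * τ)) (hlen : T + (N₀ + 1) * b ≤ T')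
    {i : ℕ} (hi : InnerBlock n b T T' i) : x i = 0 := by
  have hb' : (0 : ℝ) < b := by exact_mod_cast hb
  have hS : 0 < √(b * L) := Real.sqrt_pos.2 (by positivity)
  -- The first inner block is found by rounding `(T - 1) / b` up, the last one by rounding `(T' - 1)
  -- / b` down.
  set a := (T - 1 + (b - 1)) / b + 1 with ha
  set e' := (T' - 1) / b with he'
  have hT'n : T' ≤ n + 1 := by omega
  have hmem : ∀ j, j ∈ Finset.Icc a e' ↔ InnerBlock n b T T' j := by
    intro j
    have hkn : e' ≤ n / b := Nat.div_le_div_right (by omega)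
    constructor
    · intro hj
      rw [Finset.mem_Icc] at hj
      obtain ⟨j, rfl⟩ := Nat.exists_eq_add_of_le' (show 1 ≤ j from (Nat.le_add_left 1 _).trans hj.1)
      have h1 : (T - 1 + (b - 1)) / b ≤ j := Nat.le_of_succ_le_succ hj.1
      have h2 : (T - 1 + (b - 1)) < (j + 1) * b :=
        Nat.lt_mul_of_div_lt (Nat.lt_succ_of_le h1) hb
      have h3 : (j + 1) * b ≤ T' - 1 := (Nat.le_div_iff_mul_le hb).1 hj.2
      refine ⟨Finset.mem_Icc.2 ⟨by omega, by omega⟩, ?_, ?_⟩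
      · simp only [Nat.add_sub_cancel, Nat.add_mul, Nat.one_mul] at *; omega
      · omega
    · rintro ⟨h1, h2, h3⟩
      rw [Finset.mem_Icc] at h1 ⊢
      obtain ⟨j, rfl⟩ := Nat.exists_eq_add_of_le' h1.1
      constructor
      · have : (T - 1 + (b - 1)) / b < j + 1 := by
          rw [Nat.div_lt_iff_lt_mul hb]
          simp only [Nat.add_sub_cancel, Nat.add_mul, Nat.one_mul] at *; omega
        omega
      · rw [he', Nat.le_div_iff_mul_le hb]; omega
  -- Rounding at the two ends loses less than one block in total beyond the `N₀` that are needed.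
  have hcount : N₀ ≤ e' + 1 - a := by
    have h1 : (T - 1 + (b - 1)) / b + N₀ ≤ e' := by
      rw [he', ← Nat.add_mul_div_right _ _ hb]
      refine Nat.div_le_div_right ?_
      rw [Nat.add_mul, Nat.one_mul] at hlen
      omega
    have h2 : (T - 1 + (b - 1)) / b + 1 = a := rfl
    generalize (T - 1 + (b - 1)) / b = q at h1 h2
    omega
  refine hx.eq_zero_of_run (by positivity) (a := a) (e := e') (Nat.le_add_left 1 _)
    (Nat.div_le_div_right (by omega)) (N := 2 * τ * √(b * L)) ?_ ?_ ?_ ((hmem i).2 hi)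
  · intro j hj
    have hj' := (hmem j).1 hj
    obtain ⟨h4, h5⟩ := hj'.subset hb hT'
    have : ∑ t ∈ block n b j, y t = ∑ t ∈ block n b j, e t := by
      refine Finset.sum_congr rfl fun t ht => ?_
      rw [block, Finset.mem_Ico] at ht
      exact hy t (by omega) (by omega)
    rw [this]
    exact abs_block_noise_le hb hT hT' hτ hL.le he hj'
  · nlinarith
  · have h1 : (N₀ : ℝ) ≤ ((e' + 1 - a : ℕ) : ℝ) := by exact_mod_cast hcount
    have h2 : (N₀ : ℝ) * (C₂ - 4 * τ) ≤ ((e' + 1 - a : ℕ) : ℝ) * (C₂ - 4 * τ) :=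
      mul_le_mul_of_nonneg_right h1 (by linarith)
    have h3 := mul_lt_mul_of_pos_right (hN₀.trans_le h2) hS
    linarith

end coordinate

lemma norm_le_of_supp_subset {p d : ℕ} {v : Vec p} {A : Finset (Fin p)} (hA : A.card ≤ d)
    (hv : ∀ h, h ∉ A → v h = 0) {r : ℝ} (hr : 0 ≤ r) (hle : ∀ h, |v h| ≤ r) : ‖v‖ ≤ √d * r := by
  rw [← abs_of_nonneg (norm_nonneg v), ← Real.sqrt_sq_eq_abs, Real.sqrt_le_left (by positivity),
    mul_pow, Real.sq_sqrt (Nat.cast_nonneg d), EuclideanSpace.real_norm_sq_eq,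
    ← Finset.sum_subset (Finset.subset_univ A) (fun h _ hh => by rw [hv h hh]; simp)]
  calc ∑ h ∈ A, v h ^ 2 ≤ ∑ _h ∈ A, r ^ 2 :=
        Finset.sum_le_sum fun h _ => sq_le_sq' (abs_le.1 (hle h)).1 (abs_le.1 (hle h)).2
    _ = A.card * r ^ 2 := by rw [Finset.sum_const, nsmul_eq_mul]
    _ ≤ d * r ^ 2 := by gcongr

/-- The block fused lasso estimates the mean of a long segment on all blocks inside the segment,
without false positives. -/
lemma partialSum_estimates {p n b T T' d : ℕ} {C₁ C₂ τ L lam₁ lam₂ : ℝ} {μ : Vec p}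
    {y e Θ : ℕ → Vec p} (hn : 0 < n) (hb : 0 < b) (hT : 1 ≤ T)
    (hT' : T' = n + 1 ∨ T' + b ≤ n + 1) (hτ : 0 ≤ τ) (hL : 0 < L) (hC₁ : 0 ≤ C₁)
    (hC₂ : 4 * τ < C₂) (he : GoodNoise n τ L e)
    (hlam₁ : n * lam₁ = C₁ * √(b * L)) (hlam₂ : n * lam₂ = C₂ * √(b * L))
    (hy : ∀ t, T ≤ t → t < T' → y t = μ + e t)
    (hΘ : ∀ Θ' : ℕ → Vec p, objective n b lam₁ lam₂ y Θ ≤ objective n b lam₁ lam₂ y Θ')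
    {N₀ : ℕ} (hN₀ : 2 * C₁ < N₀ * (C₂ - 4 * τ)) (hlen : T + (N₀ + 1) * b ≤ T')
    (hd : (supp μ).card ≤ d) {i : ℕ} (hi : InnerBlock n b T T' i) :
    (∀ h, μ h = 0 → (∑ j ∈ Finset.Icc 1 i, Θ j) h = 0) ∧
      ‖∑ j ∈ Finset.Icc 1 i, Θ j - μ‖ ≤ (C₁ + C₂ / 2 + 2 * τ) * √(d * L / b) := by
  have hmin : ∀ h, IsFusedMin (n / b) (block n b) (C₁ * √(b * L)) (C₂ * √(b * L))
      (fun t => y t h) (fun i => (∑ j ∈ Finset.Icc 1 i, Θ j) h) := by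
    intro h
    rw [← hlam₁, ← hlam₂]
    exact isFusedMin_coord hn hΘ h
  have hz : ∀ h, μ h = 0 → (∑ j ∈ Finset.Icc 1 i, Θ j) h = 0 := by
    intro h hh
    refine eq_zero_of_mean_eq_zero (e := fun t => e t h) hb hT hT' hτ hL hC₁ hC₂
      (fun s u h1 h2 h3 => he s u h1 h2 h3 h) (fun t h1 h2 => ?_) (hmin h) hN₀ hlen hi
    rw [hy t h1 h2]; simp [hh]
  refine ⟨hz, ?_⟩
  rw [mul_div_assoc, Real.sqrt_mul (Nat.cast_nonneg d), mul_left_comm]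
  refine norm_le_of_supp_subset hd (fun h hh => ?_)
    (mul_nonneg (by linarith) (Real.sqrt_nonneg _)) (fun h => ?_)
  · have : μ h = 0 := by simpa [supp] using hh
    simp [this, hz h this]
  · refine abs_sub_mean_le (e := fun t => e t h) (μ := μ h) hb hT hT' hτ hL.le hC₁ (by linarith)
      (fun s u h1 h2 h3 => he s u h1 h2 h3 h) (fun t h1 h2 => ?_) (hmin h) hi
    rw [hy t h1 h2]; simp

end TBFL

namespace TBFL

/-! ### Clustering of well separated groups -/

lemma eq_self_of_strictMonoOn {m : ℕ} {f : ℕ → ℕ} (hf : ∀ l ∈ Finset.Icc 1 m, f l ∈ Finset.Icc 1 m)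
    (hmono : ∀ l ∈ Finset.Icc 1 m, ∀ l' ∈ Finset.Icc 1 m, l < l' → f l < f l') :
    ∀ l ∈ Finset.Icc 1 m, f l = l := by
  simp only [Finset.mem_Icc] at *
  have h1 : ∀ l, 1 ≤ l → l ≤ m → l ≤ f l := by
    intro l
    induction l with
    | zero => omega
    | succ l ih =>
      intro _ hm
      rcases Nat.eq_zero_or_pos l with rfl | hl
      · exact (hf 1 ⟨le_rfl, hm⟩).1
      · have := ih hl (by omega)
        have := hmono l ⟨hl, by omega⟩ (l + 1) ⟨by omega, hm⟩ (by omega)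
        omega
  have h2 : ∀ q l, 1 ≤ l → l + q = m → f l ≤ l := by
    intro q
    induction q with
    | zero => intro l hl hq; have := hf l ⟨hl, by omega⟩; omega
    | succ q ih =>
      intro l hl hq
      have := ih (l + 1) (by omega) (by omega)
      have := hmono l ⟨hl, by omega⟩ (l + 1) ⟨by omega, by omega⟩ (by omega)
      omega
  intro l hl
  exact le_antisymm (h2 (m - l) l hl.1 (by omega)) (h1 l hl.1 hl.2)

/-- A partition into groups such that elements of different groups are too far apart to belong to
one cluster is the only block clustering. -/
lemma IsClustering.eq_of_separated {n b : ℕ} {I : Finset ℕ} {m m₀ : ℕ} {J G : ℕ → Finset ℕ}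
    (hJ : IsClustering n b I m J) (hG : IsPartition n b I m₀ G)
    (hsep : ∀ j ∈ Finset.Icc 1 m₀, ∀ j' ∈ Finset.Icc 1 m₀, j < j' → ∀ i ∈ G j, ∀ i' ∈ G j',
      blockEnd n b (i - 1) + b < blockEnd n b (i' - 1)) :
    m = m₀ ∧ ∀ j ∈ Finset.Icc 1 m₀, J j = G j := by
  have hle : m ≤ m₀ := hJ.2 m₀ G hG
  have hJ := hJ.1
  have hmemG : ∀ l ∈ Finset.Icc 1 m, ∀ i ∈ J l, ∃ j ∈ Finset.Icc 1 m₀, i ∈ G j :=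
    fun l hl i hi => (hG.cover i).1 ((hJ.cover i).2 ⟨l, hl, hi⟩)
  have hdisj : ∀ j ∈ Finset.Icc 1 m₀, ∀ j' ∈ Finset.Icc 1 m₀, ∀ i, i ∈ G j → i ∈ G j' → j = j' := by
    intro j hj j' hj' i hi hi'
    rcases lt_trichotomy j j' with h | h | h
    · exact absurd (hG.increasing j hj j' hj' h i hi i hi') (lt_irrefl _)
    · exact h
    · exact absurd (hG.increasing j' hj' j hj h i hi' i hi) (lt_irrefl _)
  -- The diameter bound prevents a cluster from meeting two groups, so each cluster lies in a single
  -- group.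
  have hσ : ∀ l, ∃ j, l ∈ Finset.Icc 1 m → j ∈ Finset.Icc 1 m₀ ∧ J l ⊆ G j := by
    intro l
    by_cases hl : l ∈ Finset.Icc 1 m
    · obtain ⟨i, hi⟩ := hJ.nonempty l hl
      obtain ⟨j, hj, hij⟩ := hmemG l hl i hi
      refine ⟨j, fun _ => ⟨hj, fun i' hi' => ?_⟩⟩
      obtain ⟨j', hj', hij'⟩ := hmemG l hl i' hi'
      rcases lt_trichotomy j j' with h | h | h
      · have h1 := hsep j hj j' hj' h i hij i' hij'
        have h2 := hJ.diam l hl i hi i' hi'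
        omega
      · rwa [h]
      · have h1 := hsep j' hj' j hj h i' hij' i hij
        have h2 := hJ.diam l hl i' hi' i hi
        omega
    · exact ⟨0, fun h => absurd h hl⟩
  choose σ hσ using hσ
  -- Every group is met by a cluster, so there are at least `m₀` clusters; minimality gives the
  -- converse. The map `σ` is then an increasing bijection, hence the identity.
  have hsurj : ∀ j ∈ Finset.Icc 1 m₀, ∃ l ∈ Finset.Icc 1 m, σ l = j := by
    intro j hj
    obtain ⟨i, hi⟩ := hG.nonempty j hj
    obtain ⟨l, hl, hil⟩ := (hJ.cover i).1 ((hG.cover i).2 ⟨j, hj, hi⟩)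
    exact ⟨l, hl, hdisj _ (hσ l hl).1 _ hj i ((hσ l hl).2 hil) hi⟩
  have himg : (Finset.Icc 1 m).image σ = Finset.Icc 1 m₀ := by
    ext j
    rw [Finset.mem_image]
    exact ⟨fun ⟨l, hl, h⟩ => h ▸ (hσ l hl).1, hsurj j⟩
  have hcard : m₀ ≤ m := by
    have := Finset.card_image_le (s := Finset.Icc 1 m) (f := σ)
    rw [himg, Nat.card_Icc, Nat.card_Icc] at this
    omega
  have hmm : m = m₀ := le_antisymm hle hcard
  subst hmm
  have hinj : Set.InjOn σ (Finset.Icc 1 m : Finset ℕ) :=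
    Finset.card_image_iff.1 (by rw [himg])
  have hmono : ∀ l ∈ Finset.Icc 1 m, ∀ l' ∈ Finset.Icc 1 m, l < l' → σ l < σ l' := by
    intro l hl l' hl' hlt
    refine lt_of_le_of_ne ?_ fun h => hlt.ne (hinj hl hl' h)
    by_contra hc
    obtain ⟨i, hi⟩ := hJ.nonempty l hl
    obtain ⟨i', hi'⟩ := hJ.nonempty l' hl'
    have h1 := hJ.increasing l hl l' hl' hlt i hi i' hi'
    have h2 := hG.increasing _ (hσ l' hl').1 _ (hσ l hl).1 (not_le.1 hc) i' ((hσ l' hl').2 hi') i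
      ((hσ l hl).2 hi)
    omega
  have hid := eq_self_of_strictMonoOn (fun l hl => (hσ l hl).1) hmono
  refine ⟨rfl, fun j hj => Finset.Subset.antisymm ?_ ?_⟩
  · have := (hσ j hj).2
    rwa [hid j hj] at this
  · intro i hi
    obtain ⟨l, hl, hil⟩ := (hJ.cover i).1 ((hG.cover i).2 ⟨j, hj, hi⟩)
    have : i ∈ G l := by
      have := (hσ l hl).2 hil
      rwa [hid l hl] at this
    rwa [hdisj j hj l hl i hi this]

/-! ### The exhaustive search -/

lemma sum_norm_sub_sq_sub {p : ℕ} {y e : ℕ → Vec p} {A : Finset ℕ} {μ v v' : Vec p}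
    (hy : ∀ t ∈ A, y t = μ + e t) :
    ∑ t ∈ A, ‖y t - v'‖ ^ 2 - ∑ t ∈ A, ‖y t - v‖ ^ 2
      = A.card * (‖v' - v‖ ^ 2 - 2 * inner ℝ (v' - v) (μ - v))
        - 2 * inner ℝ (v' - v) (∑ t ∈ A, e t) := by
  rw [← Finset.sum_sub_distrib, inner_sum, Finset.mul_sum, ← nsmul_eq_mul, ← Finset.sum_const,
    ← Finset.sum_sub_distrib]
  refine Finset.sum_congr rfl fun t ht => ?_
  rw [hy t ht]
  have h1 : μ + e t - v' = (μ - v + e t) - (v' - v) := by abel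
  have h2 : μ + e t - v = μ - v + e t := by abel
  rw [h1, h2, norm_sub_sq_real, inner_add_left, real_inner_comm (v' - v) (μ - v),
    real_inner_comm (v' - v) (e t)]
  ring

/-- Only the coordinates of `w` in `A` matter, so the noise costs `√d` instead of `√p`. -/
lemma abs_inner_le_of_supp {p d : ℕ} {v w : Vec p} {A : Finset (Fin p)} (hA : A.card ≤ d)
    (hv : ∀ h, h ∉ A → v h = 0) {r : ℝ} (hr : 0 ≤ r) (hw : ∀ h, |w h| ≤ r) :
    |inner ℝ v w| ≤ ‖v‖ * (√d * r) := by
  set w' : Vec p := WithLp.toLp 2 fun h => if h ∈ A then w h else 0 with hw'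
  have h1 : inner ℝ v w = inner ℝ v w' := by
    simp only [PiLp.inner_apply, hw']
    refine Finset.sum_congr rfl fun h _ => ?_
    by_cases hh : h ∈ A
    · simp [hh]
    · simp [hv h hh]
  rw [h1]
  refine (abs_real_inner_le_norm v w').trans ?_
  gcongr
  refine norm_le_of_supp_subset hA (fun h hh => by simp [hw', hh]) hr (fun h => ?_)
  by_cases hh : h ∈ A <;> simp [hw', hh, hw h, hr]

/-- If replacing the estimate `v` of the mean `μ` by the distant `v'` on a set `A` of times does not
increase the loss, then `A` is small. -/
lemma card_mul_sq_le_of_loss_le {p d : ℕ} {y e : ℕ → Vec p} {A : Finset ℕ} {μ v v' : Vec p}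
    {D : Finset (Fin p)} (hD : D.card ≤ 2 * d) (hv : ∀ h, h ∉ D → (v' - v) h = 0)
    (hy : ∀ t ∈ A, y t = μ + e t) {τ L ν ρ : ℝ} (hτ : 0 ≤ τ) (hL : 0 ≤ L)
    (hnoise : ∀ h, |∑ t ∈ A, e t h| ≤ τ * √(A.card * L)) (hρ : ‖μ - v‖ ≤ ρ) (hν : 0 < ν)
    (hρν : 8 * ρ ≤ ν) (hvv : ν - 2 * ρ ≤ ‖v' - v‖)
    (hloss : ∑ t ∈ A, ‖y t - v'‖ ^ 2 ≤ ∑ t ∈ A, ‖y t - v‖ ^ 2) :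
    (A.card : ℝ) * ν ^ 2 ≤ 32 * τ ^ 2 * d * L := by
  have h1 := sum_norm_sub_sq_sub (v := v) (v' := v') hy
  set N : ℝ := (A.card : ℝ) with hN
  have hN0 : 0 ≤ N := Nat.cast_nonneg _
  set δ := ‖v' - v‖ with hδ
  have h2 : |inner ℝ (v' - v) (∑ t ∈ A, e t)| ≤ δ * (√((2 * d : ℕ) : ℝ) * (τ * √(N * L))) := by
    refine abs_inner_le_of_supp hD hv (by positivity) (fun h => ?_)
    have : (∑ t ∈ A, e t) h = ∑ t ∈ A, e t h := by simp
    rw [this]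
    exact hnoise h
  have h3 : inner ℝ (v' - v) (μ - v) ≤ δ * ρ :=
    (real_inner_le_norm _ _).trans (by gcongr)
  have hδν : 3 / 4 * ν ≤ δ := by linarith
  have hδ0 : 0 < δ := by linarith
  have h4 : N * (δ ^ 2 - 2 * (δ * ρ)) ≤ 2 * (δ * (√((2 * d : ℕ) : ℝ) * (τ * √(N * L)))) := by
    have := (abs_le.1 h2).2
    have h5 := mul_le_mul_of_nonneg_left h3 hN0
    nlinarith
  have h5 : N * (ν / 2) ≤ 2 * (√((2 * d : ℕ) : ℝ) * (τ * √(N * L))) := by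
    have : δ * (N * (δ - 2 * ρ)) ≤ δ * (2 * (√((2 * d : ℕ) : ℝ) * (τ * √(N * L)))) := by
      nlinarith
    have := le_of_mul_le_mul_left this hδ0
    have h6 : N * (ν / 2) ≤ N * (δ - 2 * ρ) := by gcongr; linarith
    linarith
  -- Here `δ - 2 * ρ ≥ ν - 4 * ρ ≥ ν / 2` has been used; squaring and cancelling one factor `N`
  -- yields the constant `32 = 4 * 4 * 2`.
  have h6 := pow_le_pow_left₀ (by positivity) h5 2
  simp only [mul_pow] at h6
  rw [Real.sq_sqrt (by positivity), Real.sq_sqrt (by positivity)] at h6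
  push_cast at h6
  rcases hN0.eq_or_lt with h0 | hpos
  · rw [← h0, zero_mul]; positivity
  · have : N * (N * ν ^ 2) ≤ N * (32 * τ ^ 2 * d * L) := by nlinarith
    exact le_of_mul_le_mul_left this hpos

end TBFL

namespace TBFL

/-! ### Blocks and change points -/

/-- `T 0 = 1 < T 1 < ⋯ < T (m₀ + 1) = n + 1`, with gaps of at least six blocks of length `b`. -/
structure IsGrid (n b m₀ : ℕ) (T : ℕ → ℕ) : Prop where
  b_pos : 0 < b
  first : T 0 = 1
  last : T (m₀ + 1) = n + 1
  gap : ∀ j ≤ m₀, T j + 6 * b ≤ T (j + 1)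

/-- The number of (regular) blocks that end before the time `T j`. -/
def blocksBefore (b : ℕ) (T : ℕ → ℕ) (j : ℕ) : ℕ := (T j - 1) / b

namespace IsGrid

variable {n b m₀ : ℕ} {T : ℕ → ℕ}

local notation "q" => blocksBefore b T

lemma one_le (hT : IsGrid n b m₀ T) : ∀ j ≤ m₀ + 1, 1 ≤ T j := by
  intro j
  induction j with
  | zero => intro _; exact hT.first.ge
  | succ j ih =>
    intro h
    have := hT.gap j (by omega)
    have := ih (by omega)
    omega

lemma blocksBefore_zero (hT : IsGrid n b m₀ T) : q 0 = 0 := by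
  simp [blocksBefore, hT.first]

lemma blocksBefore_last (hT : IsGrid n b m₀ T) : q (m₀ + 1) = n / b := by
  simp [blocksBefore, hT.last]

/-- At a change point `1 ≤ j ≤ m₀`, block `q j + 1` contains `T j`, and equality on the left means
that the block starts there. -/
lemma bounds (hT : IsGrid n b m₀ T) {j : ℕ} (hj : j ≤ m₀ + 1) :
    1 + q j * b ≤ T j ∧ T j ≤ q j * b + b := by
  have h1 := hT.one_le j hj
  have h2 : q j * b ≤ T j - 1 := Nat.div_mul_le_self _ _
  have h3 : T j - 1 < (q j + 1) * b := Nat.lt_mul_of_div_lt (Nat.lt_succ_self _) hT.b_pos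
  rw [Nat.add_mul, Nat.one_mul] at h3
  omega

lemma blocksBefore_succ (hT : IsGrid n b m₀ T) {j : ℕ} (hj : j ≤ m₀) :
    q j + 6 ≤ q (j + 1) := by
  have h1 := hT.one_le j (by omega)
  have h2 := hT.gap j hj
  unfold blocksBefore
  rw [← Nat.add_mul_div_right _ _ hT.b_pos]
  exact Nat.div_le_div_right (by omega)

lemma blocksBefore_lt (hT : IsGrid n b m₀ T) {j j' : ℕ} (hjj : j < j') (hj' : j' ≤ m₀ + 1) :
    q j + 6 ≤ q j' := by
  induction j' with
  | zero => omega
  | succ j' ih =>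
    have h1 := hT.blocksBefore_succ (j := j') (by omega)
    rcases Nat.lt_succ_iff_lt_or_eq.1 hjj with h | h
    · have := ih h (by omega); omega
    · rw [h]; exact h1

lemma gap_last (hT : IsGrid n b m₀ T) {j : ℕ} (hj : j ≤ m₀) :
    T (j + 1) = n + 1 ∨ T (j + 1) + b ≤ n + 1 := by
  have : ∀ l, j + 1 + l ≤ m₀ + 1 → T (j + 1) + l * b ≤ T (j + 1 + l) := by
    intro l
    induction l with
    | zero => simp
    | succ l ih =>
      intro hl
      have h1 := ih (by omega)
      have h2 := hT.gap (j + 1 + l) (by omega)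
      rw [Nat.add_mul, Nat.one_mul]
      have h3 : j + 1 + (l + 1) = j + 1 + l + 1 := rfl
      rw [h3]
      omega
  rcases hj.eq_or_lt with rfl | hlt
  · exact Or.inl hT.last
  · right
    have h1 := this (m₀ - j) (by omega)
    rw [show j + 1 + (m₀ - j) = m₀ + 1 by omega, hT.last] at h1
    have : 1 * b ≤ (m₀ - j) * b := Nat.mul_le_mul_right b (by omega)
    omega

/-- Only block `q j + 1` can straddle `T j`; when it starts at `T j`, it is inner as well, by
`inner_of_aligned`. -/
lemma inner_of_le (hT : IsGrid n b m₀ T) {j i : ℕ} (hj : j ≤ m₀) (h1 : q j + 2 ≤ i)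
    (h2 : i ≤ q (j + 1)) : InnerBlock n b (T j) (T (j + 1)) i := by
  have hk : q (j + 1) ≤ n / b := by
    rw [← hT.blocksBefore_last]
    rcases hj.eq_or_lt with rfl | hlt
    · exact le_rfl
    · have := hT.blocksBefore_lt (j := j + 1) (j' := m₀ + 1) (by omega) le_rfl
      omega
  refine ⟨Finset.mem_Icc.2 ⟨by omega, h2.trans hk⟩, ?_, ?_⟩
  · have h3 := (hT.bounds (j := j) (by omega)).2
    have h4 : (q j + 1) * b ≤ (i - 1) * b := Nat.mul_le_mul_right b (by omega)
    rw [Nat.add_mul, Nat.one_mul] at h4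
    omega
  · have h3 := (hT.bounds (j := j + 1) (by omega)).1
    have h4 : i * b ≤ q (j + 1) * b := Nat.mul_le_mul_right b h2
    omega

lemma inner_of_aligned (hT : IsGrid n b m₀ T) {j : ℕ} (hj : j ≤ m₀) (h1 : T j = 1 + q j * b) :
    InnerBlock n b (T j) (T (j + 1)) (q j + 1) := by
  have h0 := hT.blocksBefore_succ hj
  have h2 := hT.inner_of_le hj (le_refl (q j + 2)) (by omega)
  have h3 := Finset.mem_Icc.1 h2.1
  have h4 := h2.2.2
  refine ⟨Finset.mem_Icc.2 ⟨by omega, by omega⟩, by simp [h1], ?_⟩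
  have h5 : (q j + 1) * b ≤ (q j + 2) * b := Nat.mul_le_mul_right b (by omega)
  omega

lemma exists_segment (hT : IsGrid n b m₀ T) {i : ℕ} (h1 : 1 ≤ i) (h2 : i ≤ n / b) :
    ∃ j ≤ m₀, q j + 1 ≤ i ∧ i ≤ q (j + 1) := by
  by_contra! hc
  have : ∀ j ≤ m₀ + 1, q j + 1 ≤ i := by
    intro j
    induction j with
    | zero => intro _; rw [hT.blocksBefore_zero]; omega
    | succ j ih =>
      intro hj
      have := hc j (by omega) (ih (by omega))
      omega
  have := this (m₀ + 1) le_rfl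
  rw [hT.blocksBefore_last] at this
  omega

end IsGrid

/-- The lasso solution `Θ` estimates the mean vectors `μ j` on the blocks inside the segments, up
to `ρ` and without false positives. -/
def EstimatesMeans {p : ℕ} (n b m₀ : ℕ) (T : ℕ → ℕ) (μ : ℕ → Vec p) (ρ : ℝ) (Θ : ℕ → Vec p) :
    Prop :=
  ∀ j ≤ m₀, ∀ i, InnerBlock n b (T j) (T (j + 1)) i →
    (∀ h, μ j h = 0 → (∑ l ∈ Finset.Icc 1 i, Θ l) h = 0) ∧
      ‖∑ l ∈ Finset.Icc 1 i, Θ l - μ j‖ ≤ ρ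

open Classical in
/-- The candidates that belong to the `j`-th change point. -/
noncomputable def group {p : ℕ} (n b : ℕ) (T : ℕ → ℕ) (thr : ℝ≥0∞) (Θ : ℕ → Vec p) (j : ℕ) : Finset ℕ :=
  (candidates n b thr Θ).filter fun i => i = blocksBefore b T j + 1 ∨
    (i = blocksBefore b T j + 2 ∧ T j ≠ 1 + blocksBefore b T j * b)

/-! ### Candidates near the change points -/

section groups

variable {p n b m₀ : ℕ} {T : ℕ → ℕ} {μ Θ : ℕ → Vec p} {ρ ν ϖ : ℝ} {thr : ℝ≥0∞}

local notation "q" => blocksBefore b T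

lemma eq_sum_sub {i : ℕ} (hi : 1 ≤ i) :
    Θ i = ∑ l ∈ Finset.Icc 1 i, Θ l - ∑ l ∈ Finset.Icc 1 (i - 1), Θ l := by
  obtain ⟨i, rfl⟩ := Nat.exists_eq_add_of_le' hi
  rw [Finset.sum_Icc_succ_top (by omega)]
  simp

lemma mem_candidates {i : ℕ} :
    i ∈ candidates n b thr Θ ↔ (2 ≤ i ∧ i ≤ n / b) ∧ thr < ENNReal.ofReal ‖Θ i‖ := by
  simp [candidates]

/-- If blocks `i - 1` and `i` lie in the same segment, `Θ i` is the difference of two estimates of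
one mean, so its norm is at most `2 * ρ` and it fails the threshold. -/
lemma mem_group_of_mem_candidates (hT : IsGrid n b m₀ T) (hΘ : EstimatesMeans n b m₀ T μ ρ Θ)
    (hthr : ENNReal.ofReal (2 * ρ) ≤ thr) {i : ℕ} (hi : i ∈ candidates n b thr Θ) :
    ∃ j ∈ Finset.Icc 1 m₀, i ∈ group n b T thr Θ j := by
  obtain ⟨⟨h2, hk⟩, hlt⟩ := mem_candidates.1 hi
  obtain ⟨j, hj, h3, h4⟩ := hT.exists_segment (i := i) (by omega) hk
  have hnot : ∀ (_ : InnerBlock n b (T j) (T (j + 1)) (i - 1))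
      (_ : InnerBlock n b (T j) (T (j + 1)) i), False := by
    intro e1 e2
    have f1 := (hΘ j hj _ e1).2
    have f2 := (hΘ j hj _ e2).2
    have : ‖Θ i‖ ≤ 2 * ρ := by
      rw [eq_sum_sub (Θ := Θ) (by omega : 1 ≤ i), ← sub_sub_sub_cancel_right _ _ (μ j)]
      refine (norm_sub_le _ _).trans ?_
      linarith
    exact absurd hlt (not_lt.2 ((ENNReal.ofReal_le_ofReal this).trans hthr))
  have hgroup : i = q j + 1 ∨ (i = q j + 2 ∧ T j ≠ 1 + q j * b) := by
    by_contra! hc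
    rcases Nat.lt_or_ge (q j + 2) i with h5 | h5
    · exact hnot (hT.inner_of_le hj (by omega) (by omega)) (hT.inner_of_le hj (by omega) h4)
    · have h6 : i = q j + 2 := by have := hc.1; omega
      have h7 := hT.inner_of_aligned hj (hc.2 h6)
      rw [show q j + 1 = i - 1 by omega] at h7
      exact hnot h7 (hT.inner_of_le hj (by omega) h4)
  refine ⟨j, Finset.mem_Icc.2 ⟨?_, hj⟩, by classical exact Finset.mem_filter.2 ⟨hi, hgroup⟩⟩
  -- The start of the sample is aligned with a block, so `j = 0` would force `i = 1`, which is never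
  -- a candidate.
  rcases Nat.eq_zero_or_pos j with rfl | hpos
  · rw [hT.blocksBefore_zero] at hgroup
    rw [hT.first] at hgroup
    omega
  · exact hpos

/-- Between the last block before the change and the first inner block after it, the partial sums
move by at least `ν - 2 * ρ` in one or two increments. As `ν - 2 * ρ > 2 * ϖ * ν`, one increment
exceeds `ϖ * ν`; this needs `ϖ < 1 / 2`. -/
lemma group_nonempty (hT : IsGrid n b m₀ T) (hΘ : EstimatesMeans n b m₀ T μ ρ Θ) (hϖ : 0 ≤ ϖ)
    (hν : 0 ≤ ν) (hρν : 2 * ρ < (1 - 2 * ϖ) * ν) {j : ℕ} (hj : j ∈ Finset.Icc 1 m₀)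
    (hthr : thr = ENNReal.ofReal (ϖ * ν)) (hjump : ν ≤ ‖μ j - μ (j - 1)‖) :
    (group n b T thr Θ j).Nonempty := by
  classical
  obtain ⟨hj1, hj2⟩ := Finset.mem_Icc.1 hj
  have hϖν : 0 ≤ ϖ * ν := mul_nonneg hϖ hν
  have hcand : ∀ i, 2 ≤ i → i ≤ n / b → ϖ * ν < ‖Θ i‖ → i ∈ candidates n b thr Θ := by
    intro i h1 h2 h3
    refine mem_candidates.2 ⟨⟨h1, h2⟩, ?_⟩
    rw [hthr]
    exact (ENNReal.ofReal_lt_ofReal_iff (hϖν.trans_lt h3)).2 h3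
  have hq1 := hT.blocksBefore_succ (j := j - 1) (by omega)
  rw [Nat.sub_add_cancel hj1] at hq1
  have hq2 := hT.blocksBefore_succ hj2
  have hin0 := hT.inner_of_le (j := j - 1) (i := q j) (by omega) (by omega)
    (by rw [Nat.sub_add_cancel hj1])
  have hin2 := hT.inner_of_le (j := j) (i := q j + 2) hj2 le_rfl (by omega)
  have hk := (Finset.mem_Icc.1 hin2.1).2
  have f0 := (hΘ (j - 1) (by omega) _ hin0).2
  have hfar : ∀ v : Vec p, ‖v - μ j‖ ≤ ρ → ν - 2 * ρ ≤ ‖v - ∑ l ∈ Finset.Icc 1 (q j), Θ l‖ := by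
    intro v hv
    have h1 : μ j - μ (j - 1) = (v - ∑ l ∈ Finset.Icc 1 (q j), Θ l)
        - ((v - μ j) - (∑ l ∈ Finset.Icc 1 (q j), Θ l - μ (j - 1))) := by abel
    have h2 := norm_sub_le (v - ∑ l ∈ Finset.Icc 1 (q j), Θ l)
        ((v - μ j) - (∑ l ∈ Finset.Icc 1 (q j), Θ l - μ (j - 1)))
    rw [← h1] at h2
    have h3 := norm_sub_le (v - μ j) (∑ l ∈ Finset.Icc 1 (q j), Θ l - μ (j - 1))
    linarith
  have hΘ1 : Θ (q j + 1) = ∑ l ∈ Finset.Icc 1 (q j + 1), Θ l - ∑ l ∈ Finset.Icc 1 (q j), Θ l :=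
    eq_sum_sub (by omega)
  by_cases hal : T j = 1 + q j * b
  · have f1 := hfar _ (hΘ j hj2 _ (hT.inner_of_aligned hj2 hal)).2
    rw [← hΘ1] at f1
    exact ⟨q j + 1, Finset.mem_filter.2 ⟨hcand _ (by omega) (by omega) (by linarith), Or.inl rfl⟩⟩
  · by_cases h1 : ϖ * ν < ‖Θ (q j + 1)‖
    · exact ⟨q j + 1, Finset.mem_filter.2 ⟨hcand _ (by omega) (by omega) h1, Or.inl rfl⟩⟩
    · have f2 := hfar _ (hΘ j hj2 _ hin2).2
      have hΘ2 : Θ (q j + 2)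
          = ∑ l ∈ Finset.Icc 1 (q j + 2), Θ l - ∑ l ∈ Finset.Icc 1 (q j + 1), Θ l :=
        eq_sum_sub (by omega)
      have h2 : ∑ l ∈ Finset.Icc 1 (q j + 2), Θ l - ∑ l ∈ Finset.Icc 1 (q j), Θ l
          = Θ (q j + 2) + Θ (q j + 1) := by rw [hΘ1, hΘ2]; abel
      rw [h2] at f2
      have h3 := norm_add_le (Θ (q j + 2)) (Θ (q j + 1))
      refine ⟨q j + 2, Finset.mem_filter.2 ⟨hcand _ (by omega) (by omega) ?_, Or.inr ⟨rfl, hal⟩⟩⟩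
      linarith

lemma mem_group {i j : ℕ} (hi : i ∈ group n b T thr Θ j) :
    (2 ≤ i ∧ i ≤ n / b) ∧ (i = q j + 1 ∨ (i = q j + 2 ∧ T j ≠ 1 + q j * b)) := by
  classical
  obtain ⟨h1, h2⟩ := Finset.mem_filter.1 hi
  exact ⟨(mem_candidates.1 h1).1, h2⟩

lemma blockEnd_group {i j : ℕ} (hi : i ∈ group n b T thr Θ j) :
    blockEnd n b (i - 1) = 1 + (i - 1) * b := by
  have := (mem_group hi).1
  exact blockEnd_pred (Finset.mem_Icc.2 ⟨by omega, this.2⟩)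

lemma isPartition_group (hT : IsGrid n b m₀ T) (hΘ : EstimatesMeans n b m₀ T μ ρ Θ)
    (hthr : ENNReal.ofReal (2 * ρ) ≤ thr)
    (hne : ∀ j ∈ Finset.Icc 1 m₀, (group n b T thr Θ j).Nonempty) :
    IsPartition n b (candidates n b thr Θ) m₀ (group n b T thr Θ) where
  nonempty := hne
  cover i := ⟨mem_group_of_mem_candidates hT hΘ hthr, fun ⟨j, _, h⟩ => by
    classical exact (Finset.mem_filter.1 h).1⟩
  increasing j hj j' hj' hlt i hi i' hi' := by
    have h1 := (mem_group hi).2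
    have h2 := (mem_group hi').2
    have := hT.blocksBefore_lt hlt (by have := (Finset.mem_Icc.1 hj').2; omega)
    omega
  diam j hj i hi i' hi' := by
    have h1 := (mem_group hi).2
    have h2 := (mem_group hi').2
    rw [blockEnd_group hi, blockEnd_group hi']
    have : (i' - 1) * b ≤ (i - 1 + 1) * b := Nat.mul_le_mul_right b (by omega)
    rw [Nat.add_mul, Nat.one_mul] at this
    omega

lemma group_separated (hT : IsGrid n b m₀ T) :
    ∀ j ∈ Finset.Icc 1 m₀, ∀ j' ∈ Finset.Icc 1 m₀, j < j' → ∀ i ∈ group n b T thr Θ j,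
      ∀ i' ∈ group n b T thr Θ j', blockEnd n b (i - 1) + b < blockEnd n b (i' - 1) := by
  intro j hj j' hj' hlt i hi i' hi'
  have h1 := (mem_group hi).2
  have h2 := (mem_group hi').2
  have := hT.blocksBefore_lt hlt (by have := (Finset.mem_Icc.1 hj').2; omega)
  rw [blockEnd_group hi, blockEnd_group hi']
  have h3 : (i - 1 + 2) * b ≤ (i' - 1) * b := Nat.mul_le_mul_right b (by omega)
  rw [Nat.add_mul] at h3
  have := hT.b_pos
  omega

end groups

/-! ### Deterministic analysis of the procedure -/

section output

variable {p n b m₀ : ℕ} {T : ℕ → ℕ} {μ e y : ℕ → Vec p} {ρ ν ϖ lam₁ lam₂ : ℝ} {thr : ℝ≥0∞}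
  {o : Output p}

local notation "q" => blocksBefore b T

lemma Output.minIdx_mem {j : ℕ} (h : (o.J j).Nonempty) : o.minIdx j ∈ o.J j :=
  Finset.mem_coe.1 (Nat.sInf_mem (s := (o.J j : Set ℕ)) h)

lemma Output.maxIdx_mem {j : ℕ} (h : (o.J j).Nonempty) : o.maxIdx j ∈ o.J j :=
  Finset.mem_coe.1 (Nat.sSup_mem (s := (o.J j : Set ℕ)) h (Finset.bddAbove _))

lemma Output.minIdx_le {i j : ℕ} (h : i ∈ o.J j) : o.minIdx j ≤ i :=
  Nat.sInf_le (s := (o.J j : Set ℕ)) h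

lemma Output.le_maxIdx {i j : ℕ} (h : i ∈ o.J j) : i ≤ o.maxIdx j :=
  le_csSup (s := (o.J j : Set ℕ)) (Finset.bddAbove _) h

lemma Output.minIdx_eq_maxIdx_iff {j : ℕ} (h : (o.J j).Nonempty) :
    (o.J j).card = 1 ↔ o.minIdx j = o.maxIdx j := by
  constructor
  · intro hc
    obtain ⟨i, hi⟩ := Finset.card_eq_one.1 hc
    have h1 := o.minIdx_mem h
    have h2 := o.maxIdx_mem h
    rw [hi, Finset.mem_singleton] at h1 h2
    omega
  · intro heq
    refine Finset.card_eq_one.2 ⟨o.minIdx j, Finset.eq_singleton_iff_unique_mem.2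
      ⟨o.minIdx_mem h, fun i hi => ?_⟩⟩
    have h1 := o.minIdx_le hi
    have h2 := o.le_maxIdx hi
    omega

/-- The means are estimated on blocks inside the segments. -/
lemma Output.meanEst_estimates (hT : IsGrid n b m₀ T) (hΘ : EstimatesMeans n b m₀ T μ ρ o.Θ)
    (hJ0 : o.J 0 = {1}) (hJl : o.J (m₀ + 1) = {n / b})
    (hne : ∀ j ∈ Finset.Icc 1 m₀, (group n b T thr o.Θ j).Nonempty)
    (hJ : ∀ j ∈ Finset.Icc 1 m₀, o.J j = group n b T thr o.Θ j) {j : ℕ} (hj : j ≤ m₀) :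
    (∀ h, μ j h = 0 → o.meanEst (j + 1) h = 0) ∧ ‖o.meanEst (j + 1) - μ j‖ ≤ ρ := by
  have hmax : q j + 1 ≤ o.maxIdx j ∧ o.maxIdx j ≤ q j + 2 := by
    rcases Nat.eq_zero_or_pos j with rfl | hpos
    · have := o.maxIdx_mem (j := 0) (by simp [hJ0])
      rw [hJ0, Finset.mem_singleton] at this
      rw [this, hT.blocksBefore_zero]
      omega
    · have hj' := Finset.mem_Icc.2 ⟨hpos, hj⟩
      have := o.maxIdx_mem (j := j) (by rw [hJ j hj']; exact hne j hj')
      rw [hJ j hj'] at this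
      have := (mem_group this).2
      omega
  -- The lower bound is `q (j + 1)` and not `q (j + 1) + 1` because the terminal set is `{n / b}`.
  have hmin : q (j + 1) ≤ o.minIdx (j + 1) ∧ o.minIdx (j + 1) ≤ q (j + 1) + 2 := by
    rcases hj.eq_or_lt with rfl | hlt
    · have := o.minIdx_mem (j := j + 1) (by simp [hJl])
      rw [hJl, Finset.mem_singleton] at this
      rw [this, hT.blocksBefore_last]
      omega
    · have hj' : j + 1 ∈ Finset.Icc 1 m₀ := Finset.mem_Icc.2 ⟨by omega, hlt⟩
      have := o.minIdx_mem (j := j + 1) (by rw [hJ _ hj']; exact hne _ hj')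
      rw [hJ _ hj'] at this
      have := (mem_group this).2
      omega
  have hq := hT.blocksBefore_succ hj
  -- The gap of six blocks keeps the midpoint index between `q j + 2` and `q (j + 1)`.
  exact hΘ j hj _ (hT.inner_of_le hj (by rw [Nat.add_sub_cancel]; omega)
    (by rw [Nat.add_sub_cancel]; omega))

/-- The cluster of a change point, its search domain and the times used in the search. -/
lemma Output.cluster_geometry (hT : IsGrid n b m₀ T) {j : ℕ} (hj : j ∈ Finset.Icc 1 m₀)
    (hne : (group n b T thr o.Θ j).Nonempty) (hJ : o.J j = group n b T thr o.Θ j) :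
    T j ∈ o.searchDomain n b j ∧ T (j - 1) ≤ o.minR n b j - b ∧ o.maxR n b j + b ≤ T (j + 1) ∧
      ∀ s ∈ o.searchDomain n b j, o.minR n b j - b ≤ s ∧ s ≤ o.maxR n b j + b := by
  obtain ⟨hj1, hj2⟩ := Finset.mem_Icc.1 hj
  have hJne : (o.J j).Nonempty := by rw [hJ]; exact hne
  have hmin := o.minIdx_mem hJne
  have hmax := o.maxIdx_mem hJne
  have hle := o.minIdx_le hmax
  rw [hJ] at hmin hmax
  have hminR : o.minR n b j = 1 + (o.minIdx j - 1) * b := blockEnd_group hmin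
  have hmaxR : o.maxR n b j = 1 + (o.maxIdx j - 1) * b := blockEnd_group hmax
  have hb := hT.b_pos
  have hbd := hT.bounds (j := j) (by omega)
  have hbd' := hT.bounds (j := j - 1) (by omega)
  have hbd'' := hT.bounds (j := j + 1) (by omega)
  have hq1 := hT.blocksBefore_succ (j := j - 1) (by omega)
  rw [Nat.sub_add_cancel hj1] at hq1
  have hq2 := hT.blocksBefore_succ hj2
  have e1 : (q (j - 1) + 6) * b ≤ q j * b := Nat.mul_le_mul_right b hq1
  have e2 : (q j + 6) * b ≤ q (j + 1) * b := Nat.mul_le_mul_right b hq2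
  have hval : ∀ i, (i = q j + 1 ∨ (i = q j + 2 ∧ T j ≠ 1 + q j * b)) →
      (i = q j + 1 ∧ (i - 1) * b = q j * b) ∨
      (i = q j + 2 ∧ T j ≠ 1 + q j * b ∧ (i - 1) * b = q j * b + b) := by
    rintro i (rfl | ⟨rfl, h⟩)
    · left; simp
    · right
      refine ⟨rfl, h, ?_⟩
      rw [show q j + 2 - 1 = q j + 1 by omega, Nat.add_mul, Nat.one_mul]
  have hvmin := hval _ (mem_group hmin).2
  have hvmax := hval _ (mem_group hmax).2
  have hcard := o.minIdx_eq_maxIdx_iff hJne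
  rw [Nat.add_mul] at e1 e2
  generalize q j * b = Q at *
  generalize q (j - 1) * b = Q₁ at *
  generalize q (j + 1) * b = Q₂ at *
  refine ⟨?_, ?_, ?_, ?_⟩
  -- A two-element cluster, or the single index `q j + 2`, has `1 + q j * b` as the excluded left
  -- end of its domain; `T j` differs from it since index `q j + 2` enters a group only off
  -- alignment.
  · unfold Output.searchDomain
    split_ifs with hc
    · rw [hminR, hmaxR, Finset.mem_Ioo]
      have := hcard.1 hc
      omega
    · rw [hminR, hmaxR, Finset.mem_Ioo]
      rw [hcard] at hc
      omega
  · rw [hminR]; omega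
  · rw [hmaxR]; omega
  · intro s hs
    unfold Output.searchDomain at hs
    split_ifs at hs with hc
    · have := Finset.mem_Ioo.1 hs
      omega
    · have := Finset.mem_Ioo.1 hs
      omega

/-- The exhaustive search locates the change point. -/
lemma Output.cp_estimate (hT : IsGrid n b m₀ T) {d : ℕ} {τ L : ℝ} (hτ : 0 ≤ τ) (hL : 0 ≤ L)
    (he : GoodNoise n τ L e)
    (hy : ∀ j ≤ m₀, ∀ t, T j ≤ t → t < T (j + 1) → y t = μ j + e t)
    (hd : ∀ j ≤ m₀, (supp (μ j)).card ≤ d) {j : ℕ} (hj : j ∈ Finset.Icc 1 m₀)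
    (hne : (group n b T thr o.Θ j).Nonempty) (hJ : o.J j = group n b T thr o.Θ j)
    (hmean : ∀ j ≤ m₀, (∀ h, μ j h = 0 → o.meanEst (j + 1) h = 0) ∧
      ‖o.meanEst (j + 1) - μ j‖ ≤ ρ)
    (hsearch : ∀ s ∈ o.searchDomain n b j,
      o.cp j ∈ o.searchDomain n b j ∧ o.loss n b y j (o.cp j) ≤ o.loss n b y j s)
    (hν : 0 < ν) (hρν : 8 * ρ ≤ ν) (hjump : ν ≤ ‖μ j - μ (j - 1)‖) :
    |(o.cp j : ℝ) - T j| * ν ^ 2 ≤ 32 * τ ^ 2 * d * L := by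
  classical
  obtain ⟨hj1, hj2⟩ := Finset.mem_Icc.1 hj
  obtain ⟨hdom, hlo, hhi, hrange⟩ := Output.cluster_geometry hT hj hne hJ
  obtain ⟨hs, hloss⟩ := hsearch _ hdom
  obtain ⟨hs1, hs2⟩ := hrange _ hs
  obtain ⟨ht1, ht2⟩ := hrange _ hdom
  have hm1 := hmean (j - 1) (by omega)
  rw [Nat.sub_add_cancel hj1] at hm1
  have hm2 := hmean j hj2
  have hT1 := hT.one_le (j - 1) (by omega)
  have hTn : T (j + 1) ≤ n + 1 := by have := hT.gap_last hj2; omega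
  set v := o.meanEst j
  set v' := o.meanEst (j + 1)
  have hfar : ν - 2 * ρ ≤ ‖v' - v‖ := by
    have h1 : μ j - μ (j - 1) = (v' - v) - ((v' - μ j) - (v - μ (j - 1))) := by abel
    have h2 := norm_sub_le (v' - v) ((v' - μ j) - (v - μ (j - 1)))
    rw [← h1] at h2
    have h3 := norm_sub_le (v' - μ j) (v - μ (j - 1))
    linarith [hm1.2, hm2.2]
  set D := supp (μ (j - 1)) ∪ supp (μ j) with hD
  have hDcard : D.card ≤ 2 * d := by
    have : D.card ≤ _ := Finset.card_union_le (supp (μ (j - 1))) (supp (μ j))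
    have h1 := hd (j - 1) (by omega)
    have h2 := hd j hj2
    omega
  have hDz : ∀ h, h ∉ D → v h = 0 ∧ v' h = 0 := by
    intro h hh
    rw [hD, Finset.mem_union, not_or] at hh
    exact ⟨hm1.1 h (by simpa [supp] using hh.1), hm2.1 h (by simpa [supp] using hh.2)⟩
  unfold Output.loss at hloss
  -- The two losses agree outside the times between `o.cp j` and `T j`; on these the data have a
  -- single mean and are fitted by the estimate from the wrong side.
  rcases le_total (o.cp j) (T j) with hle | hle
  · rw [← Finset.sum_Ico_consecutive _ hs1 hle, ← Finset.sum_Ico_consecutive _ hle ht2] at hloss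
    have := card_mul_sq_le_of_loss_le (A := Finset.Ico (o.cp j) (T j)) (μ := μ (j - 1)) (v := v)
      (v' := v') (y := y) (e := e) hDcard (fun h hh => by simp [hDz h hh])
      (fun t ht => by
        have := Finset.mem_Ico.1 ht
        exact hy (j - 1) (by omega) t (by omega) (by rw [Nat.sub_add_cancel hj1]; omega))
      hτ hL (fun h => by
        rw [Nat.card_Ico]; exact he _ _ (by omega) hle (by omega) h)
      (by rw [norm_sub_rev]; exact hm1.2) hν hρν hfar (by linarith)
    rw [Nat.card_Ico, Nat.cast_sub hle] at this
    rwa [abs_sub_comm, abs_of_nonneg (sub_nonneg.2 (by exact_mod_cast hle))]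
  · rw [← Finset.sum_Ico_consecutive _ ht1 hle, ← Finset.sum_Ico_consecutive _ hle hs2] at hloss
    have := card_mul_sq_le_of_loss_le (A := Finset.Ico (T j) (o.cp j)) (μ := μ j) (v := v')
      (v' := v) (y := y) (e := e) hDcard (fun h hh => by simp [hDz h hh])
      (fun t ht => by
        have := Finset.mem_Ico.1 ht
        exact hy j hj2 t (by omega) (by omega))
      hτ hL (fun h => by
        rw [Nat.card_Ico]; exact he _ _ (by omega) hle (by omega) h)
      (by rw [norm_sub_rev]; exact hm2.2) hν hρν (by rw [norm_sub_rev]; exact hfar) (by linarith)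
    rw [Nat.card_Ico, Nat.cast_sub hle] at this
    rwa [abs_of_nonneg (sub_nonneg.2 (by exact_mod_cast hle))]

/-- On the event that the noise is well behaved, the procedure finds the number of change points,
locates them, and estimates the means without false positives. -/
theorem Output.IsTBFL.estimates (ho : o.IsTBFL n b lam₁ lam₂ thr y) (hn : 0 < n)
    (hT : IsGrid n b m₀ T) {d : ℕ} {C₁ C₂ τ L : ℝ} (hτ : 0 ≤ τ) (hL : 0 < L) (hC₁ : 0 ≤ C₁)
    (hC₂ : 4 * τ < C₂) (he : GoodNoise n τ L e)
    (hlam₁ : n * lam₁ = C₁ * √(b * L)) (hlam₂ : n * lam₂ = C₂ * √(b * L))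
    (hy : ∀ j ≤ m₀, ∀ t, T j ≤ t → t < T (j + 1) → y t = μ j + e t)
    (hd : ∀ j ≤ m₀, (supp (μ j)).card ≤ d)
    {N₀ : ℕ} (hN₀ : 2 * C₁ < N₀ * (C₂ - 4 * τ))
    (hlen : ∀ j ≤ m₀, T j + (N₀ + 1) * b ≤ T (j + 1))
    (hρ : ρ = (C₁ + C₂ / 2 + 2 * τ) * √(d * L / b))
    (hϖ : 0 ≤ ϖ) (hν : 0 < ν) (hρν : 8 * ρ ≤ ν) (hρν' : 2 * ρ < (1 - 2 * ϖ) * ν)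
    (hthr : ENNReal.ofReal (2 * ρ) ≤ thr)
    -- The value of `thr` is required only in the presence of a change point; without one the
    -- threshold is infinite.
    (hjump : ∀ j ∈ Finset.Icc 1 m₀, thr = ENNReal.ofReal (ϖ * ν) ∧ ν ≤ ‖μ j - μ (j - 1)‖) :
    o.m = m₀ ∧ (∀ j ∈ Finset.Icc 1 m₀, |(o.cp j : ℝ) - T j| * ν ^ 2 ≤ 32 * τ ^ 2 * d * L) ∧
      ∀ j ≤ m₀, (∀ h, μ j h = 0 → o.meanEst (j + 1) h = 0) ∧ ‖o.meanEst (j + 1) - μ j‖ ≤ ρ := by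
  have hΘ : EstimatesMeans n b m₀ T μ ρ o.Θ := fun j hj i hi => by
    rw [hρ]
    exact partialSum_estimates hn hT.b_pos (hT.one_le j (by omega)) (hT.gap_last hj) hτ hL hC₁ hC₂
      he hlam₁ hlam₂ (hy j hj) ho.lasso hN₀ (hlen j hj) (hd j hj) hi
  have hne : ∀ j ∈ Finset.Icc 1 m₀, (group n b T thr o.Θ j).Nonempty := fun j hj =>
    group_nonempty hT hΘ hϖ hν.le hρν' hj (hjump j hj).1 (hjump j hj).2
  obtain ⟨hm, hJ⟩ := ho.clustering.eq_of_separated (isPartition_group hT hΘ hthr hne)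
    (group_separated hT)
  have hJl := ho.J_last
  rw [hm] at hJl
  have hmean : ∀ j ≤ m₀, (∀ h, μ j h = 0 → o.meanEst (j + 1) h = 0) ∧
      ‖o.meanEst (j + 1) - μ j‖ ≤ ρ := fun j hj =>
    Output.meanEst_estimates hT hΘ ho.J_first hJl hne hJ hj
  refine ⟨hm, fun j hj => ?_, hmean⟩
  exact Output.cp_estimate hT hτ hL.le he hy hd hj (hne j hj) (hJ j hj) hmean
    (ho.search j (by rwa [hm])) hν hρν (hjump j hj).2

end output

end TBFL

namespace TBFL

/-! ### The model -/

namespace Params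

variable {p : ℕ} (S : Params p)

/-- The points `t_j`, indexed by natural numbers. -/
def time (j : ℕ) : ℕ := if h : j < S.m₀ + 2 then S.cp ⟨j, h⟩ else 0

/-- The mean vectors, indexed by natural numbers. -/
noncomputable def meanAt (j : ℕ) : Vec p := if h : j < S.m₀ + 1 then S.mean ⟨j, h⟩ else 0

variable {S} {n : ℕ}

lemma time_castSucc (j : Fin (S.m₀ + 1)) : S.time j = S.cp j.castSucc := by
  rw [time, dif_pos (by omega)]; rfl

lemma time_succ (j : Fin (S.m₀ + 1)) : S.time (j + 1) = S.cp j.succ := by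
  rw [time, dif_pos (by omega)]; rfl

lemma meanAt_val (j : Fin (S.m₀ + 1)) : S.meanAt j = S.mean j := by
  rw [meanAt, dif_pos j.2]

lemma minLength_le (j : Fin (S.m₀ + 1)) : S.minLength ≤ S.cp j.succ - S.cp j.castSucc :=
  ciInf_le' _ j

lemma card_supp_le (j : Fin (S.m₀ + 1)) : (supp (S.mean j)).card ≤ S.sparsity :=
  Finset.le_sup (f := fun j => (supp (S.mean j)).card) (Finset.mem_univ j)

lemma IsModel.time_add_le (hS : S.IsModel n) {l : ℕ} (hl : l ≤ S.minLength) :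
    ∀ j ≤ S.m₀, S.time j + l ≤ S.time (j + 1) := by
  intro j hj
  have h1 := S.minLength_le ⟨j, by omega⟩
  have h2 := hS.strictMono (Fin.castSucc_lt_succ (i := (⟨j, by omega⟩ : Fin (S.m₀ + 1))))
  rw [← time_castSucc, ← time_succ] at h1 h2
  simp only at h1 h2
  omega

lemma IsModel.isGrid (hS : S.IsModel n) {b : ℕ} (hb : 0 < b) (hl : 6 * b ≤ S.minLength) :
    IsGrid n b S.m₀ S.time where
  b_pos := hb
  first := by rw [time, dif_pos (by omega)]; exact hS.first
  last := by rw [time, dif_pos (by omega)]; exact hS.last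
  gap := hS.time_add_le hl

lemma IsModel.inSegment_unique (hS : S.IsModel n) {j j' : Fin (S.m₀ + 1)} {t : ℕ}
    (h : S.InSegment j t) (h' : S.InSegment j' t) : j = j' := by
  have key : ∀ j j' : Fin (S.m₀ + 1), S.InSegment j t → S.InSegment j' t → ¬ j < j' := by
    intro j j' h h' hlt
    have := hS.strictMono.monotone (Fin.succ_le_castSucc_iff.2 hlt)
    exact absurd (h.2.trans_le (this.trans h'.1)) (lt_irrefl _)
  exact le_antisymm (not_lt.1 (key _ _ h' h)) (not_lt.1 (key _ _ h h'))

lemma IsModel.obs_eq (hS : S.IsModel n) {j : Fin (S.m₀ + 1)} {t : ℕ} (h : S.InSegment j t)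
    (e : Vec p) : S.obs t e = S.mean j + e := by
  classical
  rw [obs, Finset.sum_eq_single j, if_pos h]
  · intro j' _ hne
    rw [if_neg fun h' => hne (hS.inSegment_unique h' h)]
  · simp

lemma IsModel.exists_inSegment (hS : S.IsModel n) {t : ℕ} (ht : t ∈ Finset.Icc 1 n) :
    ∃ j, S.InSegment j t := by
  obtain ⟨h1, h2⟩ := Finset.mem_Icc.1 ht
  by_contra! hc
  have : ∀ j : Fin (S.m₀ + 2), S.cp j ≤ t := by
    intro j
    induction j using Fin.induction with
    | zero => rw [hS.first]; exact h1
    | succ j ih =>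
      by_contra hlt
      exact hc j ⟨ih, not_le.1 hlt⟩
  have := this (Fin.last _)
  rw [hS.last] at this
  omega

/-- A real number that plays the role of the smallest jump also if there are no jumps. -/
lemma IsModel.exists_jump (hS : S.IsModel n) {ϖ r : ℝ} (hϖ : 0 < ϖ) (hr : 0 ≤ r)
    (hjump : ENNReal.ofReal r ≤ S.minJump) :
    ∃ ν : ℝ, 0 < ν ∧ r ≤ ν ∧ ENNReal.ofReal (ϖ * ν) ≤ ENNReal.ofReal ϖ * S.minJump ∧
      ∀ j ∈ Finset.Icc 1 S.m₀, ENNReal.ofReal ϖ * S.minJump = ENNReal.ofReal (ϖ * ν) ∧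
        ν ≤ ‖S.meanAt j - S.meanAt (j - 1)‖ ∧ ν = S.minJump.toReal := by
  rcases Nat.eq_zero_or_pos S.m₀ with h0 | hpos
  · have : IsEmpty (Fin S.m₀) := by rw [h0]; infer_instance
    have htop : S.minJump = ⊤ := by rw [minJump, iInf_of_empty]
    -- Without jumps any positive number not below `r` serves.
    refine ⟨r + 1, by linarith, by linarith, ?_, fun j hj => ?_⟩
    · rw [htop, ENNReal.mul_top (ENNReal.ofReal_pos.2 hϖ).ne']
      exact le_top
    · rw [Finset.mem_Icc] at hj; omega
  · have : Nonempty (Fin S.m₀) := ⟨⟨0, hpos⟩⟩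
    obtain ⟨j₀, hj₀⟩ := exists_eq_ciInf_of_finite
      (f := fun j : Fin S.m₀ => ENNReal.ofReal ‖S.mean j.succ - S.mean j.castSucc‖)
    have hmin : S.minJump = ENNReal.ofReal ‖S.mean j₀.succ - S.mean j₀.castSucc‖ := hj₀.symm
    set ν := ‖S.mean j₀.succ - S.mean j₀.castSucc‖ with hν
    have hν0 : 0 < ν := norm_pos_iff.2 (sub_ne_zero.2 (hS.change j₀))
    refine ⟨ν, hν0, ?_, ?_, fun j hj => ⟨?_, ?_, ?_⟩⟩
    · rw [hmin] at hjump
      exact (ENNReal.ofReal_le_ofReal_iff hν0.le).1 hjump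
    · rw [hmin, ENNReal.ofReal_mul hϖ.le]
    · rw [hmin, ENNReal.ofReal_mul hϖ.le]
    · obtain ⟨h1, h2⟩ := Finset.mem_Icc.1 hj
      obtain ⟨j, rfl⟩ := Nat.exists_eq_add_of_le' h1
      have h3 : S.minJump ≤ ENNReal.ofReal
          ‖S.mean (Fin.succ ⟨j, h2⟩) - S.mean (Fin.castSucc ⟨j, h2⟩)‖ :=
        iInf_le (fun j : Fin S.m₀ => ENNReal.ofReal ‖S.mean j.succ - S.mean j.castSucc‖) ⟨j, h2⟩
      rw [hmin, ENNReal.ofReal_le_ofReal_iff (norm_nonneg _), ← meanAt_val, ← meanAt_val] at h3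
      exact h3
    · rw [hmin, ENNReal.toReal_ofReal hν0.le]

end Params

/-- The conclusions of the analysis for one realization of the data. -/
def Recovers {p : ℕ} (S : Params p) (n b : ℕ) (K M : ℝ) (o : Output p) : Prop :=
  (o.m = S.m₀ ∧ ∀ j : Fin S.m₀, |(o.cp (j + 1) : ℝ) - (S.cp j.succ.castSucc : ℝ)| ≤
      K * (S.sparsity : ℝ) * logMax p n / S.minJump.toReal ^ 2) ∧
    ∀ j : Fin (S.m₀ + 1), (∀ h, S.mean j h = 0 → o.meanEst (j + 1) h = 0) ∧
      ‖o.meanEst (j + 1) - S.mean j‖ ≤ M * √((S.sparsity : ℝ) * logMax p n / (b : ℝ))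

lemma logMax_pos {p n : ℕ} (hn : 2 ≤ n) : 0 < logMax p n := by
  refine Real.log_pos (lt_max_of_lt_right ?_)
  exact_mod_cast hn

/-- After multiplication by `n`, the penalties are on the scale `√(b * L)` of a noise sum over one
block. -/
lemma mul_lambda_eq {n b : ℕ} (hn : 0 < n) {L : ℝ} (hL : 0 ≤ L) (C : ℝ) :
    n * (C * √(L / n) * √((b : ℝ) / n)) = C * √(b * L) := by
  have hn' : (0 : ℝ) < n := by exact_mod_cast hn
  rw [mul_assoc C, ← Real.sqrt_mul (by positivity),
    show L / n * (b / n) = b * L / (n : ℝ) ^ 2 by field_simp, Real.sqrt_div (by positivity),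
    Real.sqrt_sq hn'.le]
  field_simp

lemma recovers_of_goodNoise {p n b : ℕ} (hn : 2 ≤ n) (hb : 0 < b) {S : Params p}
    (hS : S.IsModel n) {τ C₁ C₂ M ϖ c : ℝ} (hτ : 0 < τ) (hC₁ : 0 ≤ C₁) (hC₂ : 4 * τ < C₂)
    (hM : M = C₁ + C₂ / 2 + 2 * τ) (hϖ : 0 < ϖ) (hϖ2 : ϖ < 1 / 2) (hc8 : 8 * M ≤ c)
    (hcϖ : 2 * M ≤ ϖ * c) (hcϖ' : 4 * M ≤ (1 - 2 * ϖ) * c) {N₀ : ℕ}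
    (hN₀ : 2 * C₁ < N₀ * (C₂ - 4 * τ)) (hlen : (N₀ + 6) * b ≤ S.minLength)
    (hjump : ENNReal.ofReal (c * √((S.sparsity : ℝ) * logMax p n / (b : ℝ))) ≤ S.minJump)
    {e : ℕ → Vec p} (he : GoodNoise n τ (logMax p n) e) {o : Output p}
    (ho : o.IsTBFL n b (C₁ * √(logMax p n / (n : ℝ)) * √((b : ℝ) / (n : ℝ)))
      (C₂ * √(logMax p n / (n : ℝ)) * √((b : ℝ) / (n : ℝ)))
      (ENNReal.ofReal ϖ * S.minJump) (fun t => S.obs t (e t))) :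
    Recovers S n b (32 * τ ^ 2) M o := by
  have hL := logMax_pos (p := p) hn
  set L := logMax p n
  set s := √((S.sparsity : ℝ) * L / (b : ℝ)) with hs
  have hs0 : 0 ≤ s := Real.sqrt_nonneg _
  have hM0 : 0 < M := by rw [hM]; linarith
  have hc0 : 0 < c := by linarith
  obtain ⟨ν, hν, hrν, hthr, hν'⟩ := hS.exists_jump hϖ (by positivity) hjump
  have hlen6 : 6 * b ≤ S.minLength := (Nat.mul_le_mul_right b (by omega)).trans hlen
  have hlenN : (N₀ + 1) * b ≤ S.minLength := (Nat.mul_le_mul_right b (by omega)).trans hlen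
  have h8 : 8 * (M * s) ≤ ν := by nlinarith
  have hϖ1 : 2 * (M * s) ≤ ϖ * ν := by
    calc 2 * (M * s) = (2 * M) * s := by ring
      _ ≤ (ϖ * c) * s := by gcongr
      _ = ϖ * (c * s) := by ring
      _ ≤ ϖ * ν := by gcongr
  have hϖ3 : 2 * (M * s) < (1 - 2 * ϖ) * ν := by
    have h1 : 0 < (1 - 2 * ϖ) * ν := mul_pos (by linarith) hν
    -- The factor `4` in place of `2` makes the final inequality strict, even when `s = 0`.
    have h2 : 4 * (M * s) ≤ (1 - 2 * ϖ) * ν := by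
      calc 4 * (M * s) = (4 * M) * s := by ring
        _ ≤ ((1 - 2 * ϖ) * c) * s := by gcongr
        _ = (1 - 2 * ϖ) * (c * s) := by ring
        _ ≤ (1 - 2 * ϖ) * ν := mul_le_mul_of_nonneg_left hrν (by linarith)
    linarith
  obtain ⟨hm, hcp, hmean⟩ := ho.estimates (μ := S.meanAt) (e := e) (d := S.sparsity)
    (ρ := M * s) (ν := ν) (ϖ := ϖ) (by omega) (hS.isGrid hb hlen6) hτ.le hL hC₁ hC₂ he
    (mul_lambda_eq (by omega) hL.le C₁) (mul_lambda_eq (by omega) hL.le C₂)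
    (fun j hj t h1 h2 => by
      have h3 : S.InSegment ⟨j, by omega⟩ t := by
        rw [Params.InSegment, ← Params.time_castSucc, ← Params.time_succ]
        exact ⟨h1, h2⟩
      rw [hS.obs_eq h3, ← Params.meanAt_val])
    (fun j hj => by
      have := S.card_supp_le ⟨j, by omega⟩
      rwa [← Params.meanAt_val] at this)
    hN₀ (hS.time_add_le hlenN) (by rw [hM]) hϖ.le hν h8 hϖ3
    ((ENNReal.ofReal_le_ofReal hϖ1).trans hthr)
    (fun j hj => ⟨(hν' j hj).1, (hν' j hj).2.1⟩)
  refine ⟨⟨hm, fun j => ?_⟩, fun j => ?_⟩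
  · have hj : (j : ℕ) + 1 ∈ Finset.Icc 1 S.m₀ := Finset.mem_Icc.2 ⟨by omega, by omega⟩
    have h1 := hcp _ hj
    rw [← (hν' _ hj).2.2, le_div_iff₀ (by positivity)]
    have h2 : S.time (j + 1) = S.cp j.succ.castSucc := Params.time_castSucc j.succ
    rwa [h2] at h1
  · have := hmean j (by omega)
    rwa [Params.meanAt_val] at this

end TBFL

/-! ### Choice of constants and passage to the limit -/

theorem theorem4
    -- the constants in the assumption on the errors
    (Cs Cσ : ℝ) (_hCs : 0 < Cs) (_hCσ : 0 < Cσ) :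
    -- all sufficiently large constants in the regularization parameters are allowed
    ∃ κ : ℝ, 0 < κ ∧ ∀ C₁ C₂ : ℝ, κ ≤ C₁ → κ ≤ C₂ →
    -- the hard threshold is `ϖ` times the smallest jump
    ∀ ϖ : ℝ, 0 < ϖ → ϖ < 1 / 2 →
    -- `c` is the constant in the lower bound on the jumps, `K` the one in the localization rate
    ∃ c K : ℝ, 0 < c ∧ 0 < K ∧
    ∀ (Ω : ℕ → Type*) [∀ n, MeasurableSpace (Ω n)] (P : ∀ n, Measure (Ω n))
      [∀ n, IsProbabilityMeasure (P n)]
      -- dimension, model parameters and errors for the sample size `n`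
      (p : ℕ → ℕ) (S : ∀ n, TBFL.Params (p n)) (ε : ∀ n, ℕ → Ω n → TBFL.Vec (p n))
      (_hS : ∀ n, 1 ≤ n → (S n).IsModel n)
      -- the errors: independent sub-Gaussian vectors, with parameters that depend on the segment
      (covar : ∀ n, Fin ((S n).m₀ + 1) → Matrix (Fin (p n)) (Fin (p n)) ℝ)
      (σ : ∀ n, Fin ((S n).m₀ + 1) → ℝ)
      (_hindep : ∀ n, 1 ≤ n → iIndepFun (fun t : Finset.Icc 1 n => ε n (t : ℕ)) (P n))
      (_hsub : ∀ n, 1 ≤ n → ∀ j t, (S n).InSegment j t →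
        TBFL.IsSubGaussianVector (P n) (ε n t) (covar n j) (σ n j))
      (_hcov : ∀ n, 1 ≤ n → ∀ j, ∀ e ∈ spectrum ℝ (covar n j), 1 / Cs ≤ e ∧ e ≤ Cs)
      (_hσ : ∀ n, 1 ≤ n → ∀ j, 0 ≤ σ n j ∧ 1 / Cσ < σ n j ^ 2 ∧ σ n j ^ 2 < Cσ)
      -- the mean vectors: sparse and bounded
      (_hsparse : Tendsto (fun n => ((S n).sparsity : ℝ) / (p n : ℝ)) atTop (𝓝 0))
      (Mμ : ℝ) (_hbdd : ∀ n, 1 ≤ n → ∀ j h, |(S n).mean j h| ≤ Mμ)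
      -- the block sizes
      (b : ℕ → ℕ) (_hb : ∀ n, 1 ≤ n → 0 < b n)
      (_hlength : Tendsto (fun n => ((S n).minLength : ℝ) / (b n : ℝ)) atTop atTop)
      (_hblock : Tendsto
        (fun n => ((S n).sparsity : ℝ) * TBFL.logMax (p n) n / (b n : ℝ)) atTop (𝓝 0))
      (_hjump : ∀ᶠ n in atTop, ENNReal.ofReal
        (c * √(((S n).sparsity : ℝ) * TBFL.logMax (p n) n / (b n : ℝ))) ≤ (S n).minJump)
      -- any output of the procedure
      (o : ∀ n, Ω n → TBFL.Output (p n))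
      (_ho : ∀ n, 1 ≤ n → ∀ w, (o n w).IsTBFL n (b n)
        (C₁ * √(TBFL.logMax (p n) n / (n : ℝ)) * √((b n : ℝ) / (n : ℝ)))
        (C₂ * √(TBFL.logMax (p n) n / (n : ℝ)) * √((b n : ℝ) / (n : ℝ)))
        (ENNReal.ofReal ϖ * (S n).minJump)
        (fun t => (S n).obs t (ε n t w))),
      -- number and locations of the change points; the probability of the complement of the event
      -- tends to zero (an outer measure, should the choice of the outputs not be measurable)
      Tendsto (fun n => P n {w | ¬ ((o n w).m = (S n).m₀ ∧
          ∀ j : Fin (S n).m₀,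
            |((o n w).cp (j + 1) : ℝ) - ((S n).cp j.succ.castSucc : ℝ)| ≤
              K * ((S n).sparsity : ℝ) * TBFL.logMax (p n) n / (S n).minJump.toReal ^ 2)})
        atTop (𝓝 0) ∧
      -- the mean vectors
      TBFL.IsBigOp P
        (fun n w => ⨆ j : Fin ((S n).m₀ + 1), ‖(o n w).meanEst (j + 1) - (S n).mean j‖)
        (fun n => √(((S n).sparsity : ℝ) * TBFL.logMax (p n) n / (b n : ℝ))) ∧
      -- the false positives after thresholding, for all positive constants in the thresholds
      ∀ Cη : ℕ → ℝ, (∀ j, 0 < Cη j) →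
        TBFL.IsBigOp P
          (fun n w => ((Finset.univ.sup fun j : Fin ((S n).m₀ + 1) =>
            (TBFL.supp ((o n w).meanThr
                (Cη (j + 1) * √(TBFL.logMax (p n) n / (b n : ℝ))) (j + 1)) \
              TBFL.supp ((S n).mean j)).card : ℕ) : ℝ))
          (fun n => ((S n).sparsity : ℝ)) := by
  classical
  have hproxy : 0 < TBFL.proxy Cσ := by
    have := Real.exp_pos 1
    rw [TBFL.proxy, Real.toNNReal_pos]
    positivity
  set τ : ℝ := √(8 * (TBFL.proxy Cσ : ℝ)) with hτdef
  have hproxy' : (0 : ℝ) < TBFL.proxy Cσ := by exact_mod_cast hproxy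
  have hτ : 0 < τ := Real.sqrt_pos.2 (by positivity)
  have hτ2 : 8 * (TBFL.proxy Cσ : ℝ) ≤ τ ^ 2 := by rw [hτdef, Real.sq_sqrt (by positivity)]
  -- Any bound above `4 * τ` would do, since exact zeros require `4 * τ < C₂`.
  refine ⟨8 * τ, by positivity, fun C₁ C₂ hC₁ hC₂ ϖ hϖ hϖ2 => ?_⟩
  set M : ℝ := C₁ + C₂ / 2 + 2 * τ with hM
  have hM0 : 0 < M := by rw [hM]; linarith
  have hϖ' : 0 < 1 - 2 * ϖ := by linarith
  -- The three summands of `c` serve, in this order, the exhaustive search, the exclusion of false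
  -- candidates and the nonemptiness of the groups.
  refine ⟨8 * M + 2 * M / ϖ + 4 * M / (1 - 2 * ϖ), 32 * τ ^ 2, by positivity, by positivity, ?_⟩
  set c : ℝ := 8 * M + 2 * M / ϖ + 4 * M / (1 - 2 * ϖ) with hc
  have hc1 : 0 ≤ 8 * M := by positivity
  have hc2 : 0 ≤ 2 * M / ϖ := by positivity
  have hc3 : 0 ≤ 4 * M / (1 - 2 * ϖ) := by positivity
  intro Ω _ P _ p S ε hS covar σ hindep hsub _ hσ _ _ _ b hb hlength _ hjump o ho
  -- `N₀` is the number of blocks after which the `ℓ₁` gain beats two jumps; it does not depend on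
  -- `n`, so all segments are eventually long enough.
  obtain ⟨N₀, hN₀⟩ := exists_nat_gt (2 * C₁ / (C₂ - 4 * τ))
  rw [div_lt_iff₀ (by linarith)] at hN₀
  have hcore : ∀ᶠ n : ℕ in atTop,
      P n {w | ¬ TBFL.Recovers (S n) n (b n) (32 * τ ^ 2) M (o n w)}
        ≤ ENNReal.ofReal (8 / n) := by
    filter_upwards [eventually_ge_atTop 2, hjump,
      hlength.eventually_ge_atTop ((N₀ + 6 : ℕ) : ℝ)] with n hn hjn hln
    have hn1 : 1 ≤ n := by omega
    have hbn := hb n hn1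
    have hlen : (N₀ + 6) * b n ≤ (S n).minLength := by
      rw [le_div_iff₀ (by exact_mod_cast hbn)] at hln
      exact_mod_cast hln
    refine le_trans (measure_mono ?_) (TBFL.measure_not_goodNoise_le hn1
      (hindep n hn1) (c := TBFL.proxy Cσ) (fun t ht h => ?_) hproxy hτ.le hτ2)
    · intro w hw hgood
      exact hw (TBFL.recovers_of_goodNoise hn hbn (hS n hn1) hτ (by linarith) (by linarith) hM hϖ
        hϖ2 (by linarith)
        (by rw [hc]; have : ϖ * (2 * M / ϖ) = 2 * M := by field_simp
            nlinarith)
        (by rw [hc]; have : (1 - 2 * ϖ) * (4 * M / (1 - 2 * ϖ)) = 4 * M := by field_simp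
            nlinarith)
        hN₀ hlen hjn hgood (ho n hn1 w))
    · obtain ⟨j, hj⟩ := (hS n hn1).exists_inSegment ht
      have := hσ n hn1 j
      exact (hsub n hn1 j t hj).hasSubgaussianMGF this.1 this.2.2.le _hCσ h
  have hlim : Tendsto (fun n : ℕ => ENNReal.ofReal (8 / n)) atTop (𝓝 0) := by
    have := ENNReal.tendsto_ofReal (tendsto_const_div_atTop_nhds_zero_nat (8 : ℝ))
    rwa [ENNReal.ofReal_zero] at this
  -- The bounds hold with the fixed constant `M` off an event of vanishing probability, so one
  -- constant serves every `δ`.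
  have hbigOp : ∀ (X : ∀ n, Ω n → ℝ) (a : ℕ → ℝ),
      (∀ n w, TBFL.Recovers (S n) n (b n) (32 * τ ^ 2) M (o n w) → |X n w| ≤ M * a n) →
      TBFL.IsBigOp P X a := by
    intro X a hX δ hδ
    refine ⟨M, hM0, ?_⟩
    filter_upwards [hcore, hlim.eventually_le_const (ENNReal.ofReal_pos.2 hδ)] with n h1 h2
    refine le_trans (measure_mono ?_) (h1.trans h2)
    intro w hw hrec
    exact absurd (hX n w hrec) (not_le.2 hw)
  refine ⟨?_, hbigOp _ _ fun n w hrec => ?_, fun Cη hCη => hbigOp _ _ fun n w hrec => ?_⟩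
  · refine tendsto_of_tendsto_of_tendsto_of_le_of_le' tendsto_const_nhds hlim
      (Eventually.of_forall fun _ => zero_le) ?_
    filter_upwards [hcore] with n h1
    refine le_trans (measure_mono ?_) h1
    intro w hw hrec
    exact hw hrec.1
  · rw [abs_of_nonneg (Real.iSup_nonneg fun _ => norm_nonneg _)]
    exact ciSup_le fun j => (hrec.2 j).2
  -- The estimated means have no false positives even before thresholding, and thresholding creates
  -- none.
  · have hempty : ∀ j : Fin ((S n).m₀ + 1), TBFL.supp ((o n w).meanThr
        (Cη (j + 1) * √(TBFL.logMax (p n) n / (b n : ℝ))) (j + 1)) \ TBFL.supp ((S n).mean j)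
        = ∅ := by
      intro j
      refine Finset.sdiff_eq_empty_iff_subset.2 fun h hh => ?_
      by_contra hc
      have h1 : (S n).mean j h = 0 := by simpa [TBFL.supp] using hc
      simp [TBFL.supp, TBFL.Output.meanThr, (hrec.2 j).1 h h1] at hh
    have hzero : (Finset.univ.sup fun j : Fin ((S n).m₀ + 1) =>
        (TBFL.supp ((o n w).meanThr (Cη (j + 1) * √(TBFL.logMax (p n) n / (b n : ℝ))) (j + 1)) \
          TBFL.supp ((S n).mean j)).card) = 0 := by
      simp only [hempty, Finset.card_empty]
      exact Finset.sup_const Finset.univ_nonempty 0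
    rw [hzero]
    simpa using mul_nonneg hM0.le (Nat.cast_nonneg (α := ℝ) (S n).sparsity)
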